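/- **Proposition 7.1.** Let $n\ge 1$ and let $q,t^{1/2}\in\mathbb{C}^\times$ be such that $q^at^b\neq 1$ for all integers $a\ge 1$ and $0\le b\le n-1$. The symmetric group $S_n$ acts on $\mathbb{Z}^n$ and on $\mathbb{C}[x_1^{\pm1},\dots,x_n^{\pm1}]$ by permuting coordinates and variables respectively, so that $w\varepsilon_i=\varepsilon_{w(i)}$ and $wx_i=x_{w(i)}$, where $\varepsilon_i=(0,\dots,0,1,0,\dots,0)$ with the $1$ in the $i$th spot; $s_i$ is the transposition of $i$ and $i+1$, and $\ell(w)$ is the number of inversions of $w\in S_n$. On $\mathbb{C}[x_1^{\pm1},\dots,x_n^{\pm1}]$ let $$T_i=t^{-\frac12}\Big(t-\frac{tx_i-x_{i+1}}{x_i-x_{i+1}}(1-s_i)\Big)\ (1\le i\le n-1),\qquad (T_{q^{-1},x_n}h)(x_1,\dots,x_n)=h(x_1,\dots,x_{n-1},q^{-1}x_n),$$ $$g=s_1s_2\cdots s_{n-1}T_{q^{-1},x_n},\qquad Y_1=gT_{n-1}\cdots T_1,\qquad Y_{i+1}=T_i^{-1}Y_iT_i^{-1}\ (1\le i\le n-1),$$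 and put $T_w=T_{i_1}\cdots T_{i_\ell}$ for a reduced word $w=s_{i_1}\cdots s_{i_\ell}$. For $\mu\in\mathbb{Z}^n$ let $v_\mu\in S_n$ be of minimal length such that $v_\mu\mu$ is weakly increasing. The nonsymmetric Macdonald polynomial $E_\mu$ is the unique Laurent polynomial such that $$Y_iE_\mu=q^{-\mu_i}t^{-(v_\mu(i)-1)+\frac12(n-1)}E_\mu\quad(1\le i\le n)\qquad\text{and the coefficient of }x_1^{\mu_1}\cdots x_n^{\mu_n}\text{ in }E_\mu\text{ is }1.$$ For $\lambda=(\lambda_1\ge\dots\ge\lambda_n)\in\mathbb{Z}^n$ the symmetric Macdonald polynomial is $P_\lambda=\sum_{\nu\in S_n\lambda}t^{\frac12\ell(z_\nu)}T_{z_\nu}E_\lambda$, where $z_\nu\in S_n$ is of minimal length such that $\nu=z_\nu\lambda$. Let $m_\lambda=\sum_{\gamma\in S_n\lambda}x^\gamma$ be the monomial symmetric function (a partition is padded with zeros to length $n$, and $m_\lambda=0$ if $\lambda$ has more than $n$ parts), and let $e_r$ be the $r$th elementary symmetric function. Then $E_{3\varepsilon_1}$ exists and is unique, as do and are $E_{2\varepsilon_1+\varepsilon_2}$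 if $n\ge2$ and $E_{\varepsilon_1+\varepsilon_2+\varepsilon_3}$ if $n\ge3$, and the following formulas hold. For all $n\ge 1$, $$\begin{aligned} E_{3\varepsilon_1}={}&x_1^3+\Big(\frac{1-t}{1-q^2t}\Big)q^2\sum_{k\in\{2,\dots,n\}}x_1x_k^2+\Big(\frac{1-t}{1-qt}\Big)\Big(1+\Big(\frac{1-t}{1-q^2t}\Big)q\Big)q\sum_{k\in\{2,\dots,n\}}x_1^2x_k\\ &+\Big(\frac{1-t}{1-qt}\Big)\Big(\frac{1-t}{1-q^2t}\Big)(1+q)q^2\sum_{\{k,\ell\}\subseteq\{2,\dots,n\},\,k\ne\ell}x_1x_kx_\ell,\\ P_{3\varepsilon_1}={}&m_3+\frac{1-q^3}{1-tq^2}\Big(\frac{1-t}{1-q}\Big)m_{21}+\frac{1-q^3}{1-tq^2}\,\frac{1-q^2}{1-tq}\Big(\frac{1-t}{1-q}\Big)^2m_{1^3}; \end{aligned}$$ for all $n\ge 2$, $$\begin{aligned} E_{2\varepsilon_1+\varepsilon_2}&=x_1^2x_2+\Big(\frac{1-t}{1-qt^2}\Big)q\,(x_1x_2x_n+\cdots+x_1x_2x_4+x_1x_2x_3),\\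 P_{2\varepsilon_1+\varepsilon_2}&=m_{21}+\Big(\frac{(1-t^2)}{(1-qt)}\frac{(1-q^2t)}{(1-qt^2)}+\frac{(1-t)}{(1-q)}\frac{(1-q^2)}{(1-qt)}\Big)m_{1^3}; \end{aligned}$$ and for all $n\ge 3$, $$E_{\varepsilon_1+\varepsilon_2+\varepsilon_3}=x_1x_2x_3,\qquad P_{\varepsilon_1+\varepsilon_2+\varepsilon_3}=m_{1^3}=e_3.$$ (For $n\le 2$, a coefficient in front of an empty sum or of a vanishing $m_\lambda$ plays no role, even if its denominator vanishes.) -/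

import Mathlib

namespace Macdonald

noncomputable section

/-- Laurent polynomials in `n` variables over `ℂ`. The monomial `x ^ μ` is the basis element of the
exponent vector `μ : Fin n → ℤ`. The variables are numbered from `0`. -/
abbrev Laurent (n : ℕ) : Type := AddMonoidAlgebra ℂ (Fin n → ℤ)

/-- The monomial `x ^ μ`. -/
def mono {n : ℕ} (μ : Fin n → ℤ) : Laurent n := AddMonoidAlgebra.single μ 1

/-- The exponent vector with a single `1`, at the position `i`. -/
def eps {n : ℕ} (i : Fin n) : Fin n → ℤ := Pi.single i 1

/-- The variable `x i`. -/
def x {n : ℕ} (i : Fin n) : Laurent n := mono (eps i)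

/-! ### The symmetric group -/

/-- The action of a permutation on exponent vectors, with `w (eps i) = eps (w i)`. -/
def permVec {n : ℕ} (w : Equiv.Perm (Fin n)) : (Fin n → ℤ) →+ (Fin n → ℤ) :=
  (LinearMap.funLeft ℤ ℤ (w⁻¹ : Equiv.Perm (Fin n))).toAddMonoidHom

/-- The action of a permutation on Laurent polynomials, with `w (x i) = x (w i)`. -/
def perm {n : ℕ} (w : Equiv.Perm (Fin n)) : Laurent n →ₐ[ℂ] Laurent n :=
  AddMonoidAlgebra.mapDomainAlgHom ℂ ℂ (permVec w)

/-- The length (number of inversions) of a permutation. -/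
def length {n : ℕ} (w : Equiv.Perm (Fin n)) : ℕ :=
  (Finset.univ.filter fun p : Fin n × Fin n => p.1 < p.2 ∧ w p.2 < w p.1).card

/-- The adjacent transpositions of `m + 1` letters. -/
def simple {m : ℕ} (i : Fin m) : Equiv.Perm (Fin (m + 1)) := Equiv.swap i.castSucc i.succ

/-- The word `l` in the adjacent transpositions is a reduced word of `w`. -/
def IsReducedWord {m : ℕ} (w : Equiv.Perm (Fin (m + 1))) (l : List (Fin m)) : Prop :=
  (l.map simple).prod = w ∧ l.length = length w

/-- `w` has minimal length among the elements of `S`. -/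
def IsMinLength {n : ℕ} (S : Set (Equiv.Perm (Fin n))) (w : Equiv.Perm (Fin n)) : Prop :=
  w ∈ S ∧ ∀ u ∈ S, length w ≤ length u

/-- The permutation `v` of minimal length such that `v μ` is weakly increasing. -/
def sortPerm {n : ℕ} (μ : Fin n → ℤ) : Equiv.Perm (Fin n) :=
  Classical.epsilon (IsMinLength {w | Monotone (permVec w μ)})

/-- The permutation `z` of minimal length such that `ν = z lam`. -/
def transport {n : ℕ} (lam ν : Fin n → ℤ) : Equiv.Perm (Fin n) :=
  Classical.epsilon (IsMinLength {w | permVec w lam = ν})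

/-- The set of rearrangements of `lam`. -/
def orbit {n : ℕ} (lam : Fin n → ℤ) : Finset (Fin n → ℤ) :=
  Finset.univ.image fun w : Equiv.Perm (Fin n) => permVec w lam

/-! ### The operators

From here on there are `m + 1` variables, and `s` is the square root of `t`, that is `t = s ^ 2`. -/

/-- The quotient of `x ^ μ - s_i x ^ μ` by `x_i - x_{i+1}`, written out. -/
def divDiffMono {m : ℕ} (i : Fin m) (μ : Fin (m + 1) → ℤ) : Laurent (m + 1) :=
  if μ i.succ ≤ μ i.castSucc then
    ∑ k ∈ Finset.range (μ i.castSucc - μ i.succ).toNat,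
      mono (μ - ((k : ℤ) + 1) • eps i.castSucc + (k : ℤ) • eps i.succ)
  else
    -∑ k ∈ Finset.range (μ i.succ - μ i.castSucc).toNat,
      mono (μ + (k : ℤ) • eps i.castSucc - ((k : ℤ) + 1) • eps i.succ)

/-- The divided difference operator `f ↦ (f - s_i f) / (x_i - x_{i+1})`; see `divDiff_spec` and
`eq_divDiff`. -/
def divDiff {m : ℕ} (i : Fin m) : Module.End ℂ (Laurent (m + 1)) :=
  Finsupp.linearCombination ℂ (divDiffMono i) ∘ₗ
    (AddMonoidAlgebra.coeffLinearEquiv ℂ).toLinearMap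

/-- The operator
`T_i = t ^ (-1/2) (t - (t x_i - x_{i+1}) / (x_i - x_{i+1}) (1 - s_i))`. -/
def T {m : ℕ} (s : ℂ) (i : Fin m) : Module.End ℂ (Laurent (m + 1)) :=
  s⁻¹ • (s ^ 2 • LinearMap.id -
    LinearMap.mulLeft ℂ (s ^ 2 • x i.castSucc - x i.succ) ∘ₗ divDiff i)

/-- The inverse of `T_i`; see `T_mul_Tinv` and `Tinv_mul_T`. -/
def Tinv {m : ℕ} (s : ℂ) (i : Fin m) : Module.End ℂ (Laurent (m + 1)) :=
  T s i - (s - s⁻¹) • LinearMap.id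

/-- The operator replacing the last variable `x_n` by `q⁻¹ x_n`. -/
def qShift {m : ℕ} (q : ℂ) : Module.End ℂ (Laurent (m + 1)) :=
  Finsupp.linearCombination ℂ (fun μ : Fin (m + 1) → ℤ => q ^ (-μ (Fin.last m)) • mono μ) ∘ₗ
    (AddMonoidAlgebra.coeffLinearEquiv ℂ).toLinearMap

/-- The operator `g = s_1 s_2 ⋯ s_{n-1} T_{q⁻¹, x_n}`. -/
def g {m : ℕ} (q : ℂ) : Module.End ℂ (Laurent (m + 1)) :=
  (List.ofFn fun i : Fin m => (perm (simple i)).toLinearMap).prod * qShift q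

/-- The Cherednik-Dunkl operators: the first one is `g T_{n-1} ⋯ T_1`, and each further one is
`T_i⁻¹ Y_i T_i⁻¹`. -/
def Y {m : ℕ} (q s : ℂ) : Fin (m + 1) → Module.End ℂ (Laurent (m + 1)) :=
  Fin.induction (g q * (List.ofFn fun i : Fin m => T s i).reverse.prod)
    fun i y => Tinv s i * y * Tinv s i

/-- The product of the `T_i` along a reduced word of `w`. -/
def TPerm {m : ℕ} (s : ℂ) (w : Equiv.Perm (Fin (m + 1))) : Module.End ℂ (Laurent (m + 1)) :=
  ((Classical.epsilon (IsReducedWord w)).map (T s)).prod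

/-! ### Macdonald polynomials -/

/-- The defining property of the nonsymmetric Macdonald polynomial of `μ`:
`Y_i f = q ^ (-μ_i) t ^ (-(v_μ(i) - 1) + (n - 1) / 2) f` for all `i`, and the coefficient of
`x ^ μ` is `1`. As the positions are numbered from `0`, the value of `sortPerm μ i` already is
`v_μ(i) - 1`, and `n - 1 = m`. -/
def IsE {m : ℕ} (q s : ℂ) (μ : Fin (m + 1) → ℤ) (f : Laurent (m + 1)) : Prop :=
  (∀ i, Y q s i f = (q ^ (-μ i) * s ^ (-2 * ((sortPerm μ i : ℕ) : ℤ) + (m : ℤ))) • f) ∧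
    f.coeff μ = 1

/-- The nonsymmetric Macdonald polynomial. -/
def E {m : ℕ} (q s : ℂ) (μ : Fin (m + 1) → ℤ) : Laurent (m + 1) :=
  Classical.epsilon (IsE q s μ)

/-- The symmetric Macdonald polynomial
`∑ t ^ (ℓ(z_ν) / 2) T_{z_ν} E_lam`, summed over the rearrangements `ν` of `lam`. -/
def P {m : ℕ} (q s : ℂ) (lam : Fin (m + 1) → ℤ) : Laurent (m + 1) :=
  ∑ ν ∈ orbit lam, s ^ length (transport lam ν) • TPerm s (transport lam ν) (E q s lam)

/-- The monomial symmetric polynomial in `n` variables of a partition, given by the list `p` of its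
parts: the sum of the monomials in the orbit of `(p, 0, …, 0)`, which is `0` if there are more
parts than variables. -/
def monomialSymm (n : ℕ) (p : List ℤ) : Laurent n :=
  if p.length ≤ n then ∑ γ ∈ orbit (fun i : Fin n => p.getD i 0), mono γ else 0

/-- The elementary symmetric polynomial of degree `r` in `n` variables. -/
def elemSymm (n r : ℕ) : Laurent n := MvPolynomial.aeval x (MvPolynomial.esymm (Fin n) ℂ r)

/-! ### The divided differences and the inverses are what they should be -/

theorem mono_mul {n : ℕ} (μ ν : Fin n → ℤ) : mono μ * mono ν = mono (μ + ν) := by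
  simp [mono, AddMonoidAlgebra.single_mul_single]

theorem perm_mono {n : ℕ} (w : Equiv.Perm (Fin n)) (μ : Fin n → ℤ) :
    perm w (mono μ) = mono (permVec w μ) := by
  simp [perm, mono]

theorem linearMap_ext {n : ℕ} {φ ψ : Module.End ℂ (Laurent n)}
    (h : ∀ μ, φ (mono μ) = ψ (mono μ)) : φ = ψ := by
  ext μ : 2
  exact h μ

theorem permVec_apply {n : ℕ} (w : Equiv.Perm (Fin n)) (μ : Fin n → ℤ) (i : Fin n) :
    permVec w μ i = μ (w⁻¹ i) := rfl

theorem permVec_eps {n : ℕ} (w : Equiv.Perm (Fin n)) (i : Fin n) :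
    permVec w (eps i) = eps (w i) := by
  ext j
  rw [permVec_apply]
  simp only [eps, Pi.single_apply, Equiv.Perm.inv_eq_iff_eq]

theorem perm_x {n : ℕ} (w : Equiv.Perm (Fin n)) (i : Fin n) : perm w (x i) = x (w i) := by
  simp [x, perm_mono, permVec_eps]

theorem divDiff_mono {m : ℕ} (i : Fin m) (μ : Fin (m + 1) → ℤ) :
    divDiff i (mono μ) = divDiffMono i μ := by
  simp [divDiff, mono]

theorem qShift_mono {m : ℕ} (q : ℂ) (μ : Fin (m + 1) → ℤ) :
    qShift q (mono μ) = q ^ (-μ (Fin.last m)) • mono μ := by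
  simp [qShift, mono]

theorem x_sub_x_ne_zero {m : ℕ} (i : Fin m) :
    (x i.castSucc - x i.succ : Laurent (m + 1)) ≠ 0 := by
  intro h
  have h1 : (mono (eps i.castSucc) : Laurent (m + 1)) = mono (eps i.succ) := sub_eq_zero.mp h
  have h2 := congrArg (fun f : Laurent (m + 1) => f.coeff (eps i.castSucc)) h1
  have h3 : (eps i.succ : Fin (m + 1) → ℤ) ≠ eps i.castSucc := by
    intro h4
    have h5 := congrFun h4 i.succ
    have h6 : i.succ ≠ i.castSucc := (Fin.castSucc_lt_succ (i := i)).ne'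
    simp [eps, h6] at h5
  simp [mono, h3] at h2

theorem permVec_simple {m : ℕ} (i : Fin m) (μ : Fin (m + 1) → ℤ) :
    permVec (simple i) μ =
      μ - (μ i.castSucc - μ i.succ) • eps i.castSucc + (μ i.castSucc - μ i.succ) • eps i.succ := by
  have h6 : i.succ ≠ i.castSucc := (Fin.castSucc_lt_succ (i := i)).ne'
  ext j
  rw [permVec_apply, simple, Equiv.swap_inv]
  rcases eq_or_ne j i.castSucc with rfl | h
  · simp [eps, h6.symm]
  · rcases eq_or_ne j i.succ with rfl | h'
    · simp [eps, h6]
    · simp [eps, h, h', Equiv.swap_apply_of_ne_of_ne]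

theorem divDiffMono_spec {m : ℕ} (i : Fin m) (μ : Fin (m + 1) → ℤ) :
    (x i.castSucc - x i.succ) * divDiffMono i μ = mono μ - mono (permVec (simple i) μ) := by
  rw [divDiffMono]
  split_ifs with h
  · rw [Finset.mul_sum]
    have key : ∀ k ∈ Finset.range (μ i.castSucc - μ i.succ).toNat,
        (x i.castSucc - x i.succ) *
          mono (μ - ((k : ℤ) + 1) • eps i.castSucc + (k : ℤ) • eps i.succ) =
        mono (μ - (k : ℤ) • eps i.castSucc + (k : ℤ) • eps i.succ) -
          mono (μ - ((k + 1 : ℕ) : ℤ) • eps i.castSucc + ((k + 1 : ℕ) : ℤ) • eps i.succ) := by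
      intro k _
      rw [sub_mul, x, x, mono_mul, mono_mul]
      congr 2
      · module
      · push_cast; module
    rw [Finset.sum_congr rfl key, Finset.sum_range_sub'
      (fun k : ℕ => mono (μ - (k : ℤ) • eps i.castSucc + (k : ℤ) • eps i.succ)), permVec_simple,
      Int.toNat_of_nonneg (by omega)]
    simp
  · rw [mul_neg, Finset.mul_sum]
    have key : ∀ k ∈ Finset.range (μ i.succ - μ i.castSucc).toNat,
        (x i.castSucc - x i.succ) *
          mono (μ + (k : ℤ) • eps i.castSucc - ((k : ℤ) + 1) • eps i.succ) =
        mono (μ + ((k + 1 : ℕ) : ℤ) • eps i.castSucc - ((k + 1 : ℕ) : ℤ) • eps i.succ) -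
          mono (μ + (k : ℤ) • eps i.castSucc - (k : ℤ) • eps i.succ) := by
      intro k _
      rw [sub_mul, x, x, mono_mul, mono_mul]
      congr 2
      · push_cast; module
      · module
    rw [Finset.sum_congr rfl key, Finset.sum_range_sub
      (fun k : ℕ => mono (μ + (k : ℤ) • eps i.castSucc - (k : ℤ) • eps i.succ)), permVec_simple,
      Int.toNat_of_nonneg (by omega), neg_sub]
    congr 2
    · simp
    · module

theorem divDiff_spec {m : ℕ} (i : Fin m) (f : Laurent (m + 1)) :
    (x i.castSucc - x i.succ) * divDiff i f = f - perm (simple i) f := by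
  suffices h : LinearMap.mulLeft ℂ (x i.castSucc - x i.succ) ∘ₗ divDiff i =
      LinearMap.id - (perm (simple i)).toLinearMap from LinearMap.congr_fun h f
  refine linearMap_ext fun μ => ?_
  have h := divDiffMono_spec i μ
  rw [← divDiff_mono, ← perm_mono] at h
  exact h

theorem eq_divDiff {m : ℕ} (i : Fin m) (f h : Laurent (m + 1))
    (hh : (x i.castSucc - x i.succ) * h = f - perm (simple i) f) : h = divDiff i f :=
  mul_left_cancel₀ (x_sub_x_ne_zero i) (hh.trans (divDiff_spec i f).symm)

theorem T_mul_T {m : ℕ} {s : ℂ} (hs : s ≠ 0) (i : Fin m) :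
    T s i * T s i = (s - s⁻¹) • T s i + 1 := by
  have hT : ∀ f, s • T s i f = s ^ 2 • f - (s ^ 2 • x i.castSucc - x i.succ) * divDiff i f := by
    intro f
    simp [T, smul_smul, hs]
  have hX : perm (simple i) (x i.castSucc) = x i.succ := by simp [perm_x, simple]
  have hY : perm (simple i) (x i.succ) = x i.castSucc := by simp [perm_x, simple]
  have hinv : ∀ f, perm (simple i) (perm (simple i) f) = f := by
    intro f
    have h1 : (perm (simple i)).toLinearMap ∘ₗ (perm (simple i)).toLinearMap =
        (LinearMap.id : Module.End ℂ (Laurent (m + 1))) := by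
      refine linearMap_ext fun μ => ?_
      change perm (simple i) (perm (simple i) (mono μ)) = mono μ
      rw [perm_mono, perm_mono]
      congr 1
      ext j
      simp [permVec_apply, simple]
    exact LinearMap.congr_fun h1 f
  have hmul : ∀ f, (x i.castSucc - x i.succ) * (s • T s i f) =
      (1 - algebraMap ℂ _ (s ^ 2)) * x i.succ * f +
        (algebraMap ℂ _ (s ^ 2) * x i.castSucc - x i.succ) * perm (simple i) f := by
    intro f
    have h := divDiff_spec i f
    rw [hT, Algebra.smul_def, Algebra.smul_def]
    linear_combination (-(algebraMap ℂ _ (s ^ 2) * x i.castSucc - x i.succ)) * h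
  refine LinearMap.ext fun f => ?_
  have hA := hmul f
  have hA' := congrArg (perm (simple i)) hA
  have hB := hmul (s • T s i f)
  simp only [map_mul, map_sub, map_add, map_one, hX, hY, hinv, AlgHom.commutes] at hA'
  have hG : s • T s i (s • T s i f) = (s ^ 2 - 1) • (s • T s i f) + s ^ 2 • f := by
    refine mul_left_cancel₀ (x_sub_x_ne_zero i) (mul_left_cancel₀ (x_sub_x_ne_zero i) ?_)
    simp only [Algebra.smul_def (s ^ 2 - 1), Algebra.smul_def (s ^ 2) f, map_sub, map_one]
    linear_combination (x i.castSucc - x i.succ) * hB +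
      (1 - algebraMap ℂ _ (s ^ 2)) * x i.succ * hA -
      (algebraMap ℂ _ (s ^ 2) * x i.castSucc - x i.succ) * hA' -
      (x i.castSucc - x i.succ) * (algebraMap ℂ _ (s ^ 2) - 1) * hA
  have hG' := congrArg (fun f => (s ^ 2)⁻¹ • f) hG
  have e1 : (s ^ 2)⁻¹ * (s * s) = 1 := by field_simp
  have e2 : (s ^ 2)⁻¹ * ((s ^ 2 - 1) * s) = s - s⁻¹ := by field_simp
  have e3 : (s ^ 2)⁻¹ * s ^ 2 = 1 := by field_simp
  simp only [map_smul, smul_add, smul_smul, e1, e2, e3, one_smul] at hG'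
  simpa using hG'

theorem T_mul_Tinv {m : ℕ} {s : ℂ} (hs : s ≠ 0) (i : Fin m) : T s i * Tinv s i = 1 := by
  have h := T_mul_T hs i
  rw [Tinv, mul_sub, h, ← Module.End.one_eq_id, mul_smul_comm, mul_one]
  abel

theorem Tinv_mul_T {m : ℕ} {s : ℂ} (hs : s ≠ 0) (i : Fin m) : Tinv s i * T s i = 1 := by
  have h := T_mul_T hs i
  rw [Tinv, sub_mul, h, ← Module.End.one_eq_id, smul_mul_assoc, one_mul]
  abel

end

end Macdonald

namespace Macdonald

noncomputable section

/-! ### Permutations of exponent vectors -/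

/-! Uniqueness comes from triangularity, existence from explicit families that the Hecke operators
permute.

Uniqueness. Order exponent vectors by the norm `ν ⬝ᵥ ν` and then by `π ⬝ᵥ ν` for a strictly
increasing `π`. Up to lower terms, `T_i` and its inverse send `x^ν` to a power of `s` times `x^{s_i
ν}`, provided that `π` is permuted along with `ν`, while `g` sends monomials to multiples of
monomials. The permutations in `Y_i = T_{i-1}⁻¹ ⋯ T_1⁻¹ g T_{n-1} ⋯ T_i` cancel, so `Y_i x^ν` is a
multiple of `x^ν` plus lower terms (`Y_mono_sub_mem`). A nonzero joint eigenvector therefore has the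
eigenvalues of one of its own exponents (`exists_eigenvalue`). By the genericity of `q` and `t` the
eigenvalues determine the exponent (`eigenvalue_injective`), so the difference of two candidates for
`E_μ`, in which `x^μ` has coefficient zero, vanishes.

Existence. Let `λ` be weakly decreasing, and suppose that polynomials `F_ν`, indexed by the
rearrangements `ν` of `λ`, satisfy `s T_i F_ν = F_{s_i ν}` at strict descents of `ν`, `T_i F_ν = s
F_ν` at equal entries, and that `g` rotates them up to powers of `q`. Then `Y_i` carries `F_λ`
around a closed path, so `F_λ` is a joint eigenvector (`IsKZFamily.Y_apply`). The same relations
turn each summand of `P_λ` into `F_ν`, whence `P_λ = ∑ F_ν` (`IsKZFamily.P_eq`).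

What remains is to write down the families: `cubic` for `3ε_1`, `pairPoly` for `2ε_1 + ε_2`, and
plain monomials for `ε_1 + ε_2 + ε_3`. The relations reduce to a few scalar identities between
coefficients, and the sums over the orbits are expanded in monomial symmetric functions by
symmetrizing over triples of variables. -/

theorem permVec_mul {n : ℕ} (w u : Equiv.Perm (Fin n)) (μ : Fin n → ℤ) :
    permVec (w * u) μ = permVec w (permVec u μ) := by
  ext i
  simp [permVec_apply]

theorem permVec_one {n : ℕ} (μ : Fin n → ℤ) : permVec 1 μ = μ := by
  ext i
  simp [permVec_apply]

theorem simple_mul_simple {m : ℕ} (i : Fin m) : simple i * simple i = 1 :=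
  Equiv.swap_mul_self _ _

theorem simple_inv {m : ℕ} (i : Fin m) : (simple i)⁻¹ = simple i := Equiv.swap_inv _ _

theorem simple_castSucc {m : ℕ} (i : Fin m) : simple i i.castSucc = i.succ :=
  Equiv.swap_apply_left _ _

theorem simple_succ {m : ℕ} (i : Fin m) : simple i i.succ = i.castSucc :=
  Equiv.swap_apply_right _ _

theorem simple_of_ne {m : ℕ} {i : Fin m} {j : Fin (m + 1)} (h : j ≠ i.castSucc)
    (h' : j ≠ i.succ) : simple i j = j :=
  Equiv.swap_apply_of_ne_of_ne h h'

theorem permVec_simple_apply {m : ℕ} (i : Fin m) (μ : Fin (m + 1) → ℤ) (j : Fin (m + 1)) :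
    permVec (simple i) μ j = μ (simple i j) := by
  rw [permVec_apply, simple_inv]

theorem permVec_simple_simple {m : ℕ} (i : Fin m) (μ : Fin (m + 1) → ℤ) :
    permVec (simple i) (permVec (simple i) μ) = μ := by
  rw [← permVec_mul, simple_mul_simple, permVec_one]

/-! ### Partial products -/

/-- The product `f_0 f_1 ⋯ f_{k-1}`. -/
def upProd {M : Type*} [Monoid M] {m : ℕ} (f : Fin m → M) (k : ℕ) : M :=
  ((List.ofFn f).take k).prod

/-- The product `f_{m-1} ⋯ f_{k+1} f_k`. -/
def downProd {M : Type*} [Monoid M] {m : ℕ} (f : Fin m → M) (k : ℕ) : M :=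
  ((List.ofFn f).drop k).reverse.prod

section Products

variable {M : Type*} [Monoid M] {m : ℕ} (f : Fin m → M)

theorem upProd_zero : upProd f 0 = 1 := by simp [upProd]

theorem upProd_succ (i : Fin m) : upProd f (i + 1) = upProd f i * f i := by
  rw [upProd, List.prod_take_succ _ _ (by simp)]
  simp [upProd]

theorem upProd_last : upProd f m = (List.ofFn f).prod := by
  rw [upProd, List.take_of_length_le (by simp)]

theorem downProd_last : downProd f m = 1 := by
  rw [downProd, List.drop_of_length_le (by simp)]
  simp

theorem downProd_eq_mul (i : Fin m) : downProd f i = downProd f (i + 1) * f i := by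
  rw [downProd, List.drop_eq_getElem_cons (by simp)]
  simp [downProd]

theorem downProd_zero : downProd f 0 = (List.ofFn f).reverse.prod := by simp [downProd]

end Products

/-- The permutation `s_1 s_2 ⋯ s_{n-1}`. -/
def rotation (m : ℕ) : Equiv.Perm (Fin (m + 1)) := (List.ofFn (simple (m := m))).prod

/-- Each `s_i` is an involution, so removing factors from the descending product cancels the tail of
the rotation. This is why the permutations underlying the factors of `Y_i` compose to the identity.
-/
theorem rotation_mul_downProd {m : ℕ} (i : Fin (m + 1)) :
    rotation m * downProd simple i = upProd simple i := by
  induction i using Fin.reverseInduction with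
  | last => simp [downProd_last, upProd_last, rotation]
  | cast i ih =>
    rw [Fin.val_succ, upProd_succ] at ih
    rw [Fin.val_castSucc, downProd_eq_mul, ← mul_assoc, ih, mul_assoc, simple_mul_simple, mul_one]

theorem permVec_downProd_last {m : ℕ} (i : Fin (m + 1)) (μ : Fin (m + 1) → ℤ) :
    permVec (downProd simple i) μ (Fin.last m) = μ i := by
  induction i using Fin.reverseInduction generalizing μ with
  | last => simp [downProd_last, permVec_one]
  | cast i ih =>
    rw [Fin.val_succ] at ih
    rw [Fin.val_castSucc, downProd_eq_mul, permVec_mul, ih, permVec_simple_apply, simple_succ]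

/-- In `rotation_mul_downProd` at `i + 1` the descending product involves only later transpositions
and fixes `i`, while `s_i`, the last factor of the ascending product, moves `i` to `i + 1`, which
the earlier factors fix. -/
theorem rotation_castSucc {m : ℕ} (i : Fin m) : rotation m i.castSucc = i.succ := by
  have h (k : Fin (m + 1)) : k ≤ i.castSucc → downProd (simple (m := m)) (i + 1) k = k := by
    intro hk
    have h' (j : Fin (m + 1)) : k < j → downProd (simple (m := m)) j k = k := by
      induction j using Fin.reverseInduction with
      | last => simp [downProd_last]
      | cast j ih =>
        intro hj
        have h1 : k < j.succ := hj.trans Fin.castSucc_lt_succ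
        rw [Fin.val_castSucc, downProd_eq_mul, Equiv.Perm.mul_apply,
          simple_of_ne hj.ne h1.ne, ← Fin.val_succ, ih h1]
    exact h' i.succ (hk.trans_lt Fin.castSucc_lt_succ)
  have h2 (j : Fin (m + 1)) (k : Fin (m + 1)) : j < k → upProd (simple (m := m)) j k = k := by
    induction j using Fin.induction with
    | zero => simp [upProd_zero]
    | succ j ih =>
      intro hj
      have h1 : j.castSucc < k := Fin.castSucc_lt_succ.trans hj
      rw [Fin.val_succ, upProd_succ, Equiv.Perm.mul_apply, simple_of_ne h1.ne' hj.ne']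
      exact ih h1
  have h3 := congrArg (fun w : Equiv.Perm (Fin (m + 1)) => w i.castSucc)
    (rotation_mul_downProd i.succ)
  simp only [Equiv.Perm.mul_apply, Fin.val_succ, h _ le_rfl, upProd_succ, simple_castSucc] at h3
  rw [h3]
  exact h2 i.castSucc i.succ Fin.castSucc_lt_succ

theorem rotation_last (m : ℕ) : rotation m (Fin.last m) = 0 := by
  by_contra h
  obtain ⟨j, hj⟩ := Fin.exists_succ_eq.mpr h
  rw [← rotation_castSucc] at hj
  exact (Fin.castSucc_lt_last j).ne ((rotation m).injective hj)

theorem list_perm_mono {m : ℕ} (l : List (Fin m)) (μ : Fin (m + 1) → ℤ) :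
    (l.map fun i => (perm (simple i)).toLinearMap).prod (mono μ) =
      mono (permVec (l.map simple).prod μ) := by
  induction l with
  | nil => simp [permVec_one]
  | cons i l ih => simp [ih, permVec_mul, perm_mono]

theorem g_mono {m : ℕ} (q : ℂ) (μ : Fin (m + 1) → ℤ) :
    g q (mono μ) = q ^ (-μ (Fin.last m)) • mono (permVec (rotation m) μ) := by
  rw [g, Module.End.mul_apply, qShift_mono, map_smul, List.ofFn_eq_map, list_perm_mono,
    ← List.ofFn_eq_map, rotation]

/-! ### The operators `Y_i` along a chain -/

/-- In `T_i⁻¹ Y_i T_i⁻¹` the right-hand inverse cancels the factor `T_i` at the end of the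
descending product, and the left-hand one extends `A`. -/
theorem Y_eq {m : ℕ} {q s : ℂ} (hs : s ≠ 0) (i : Fin (m + 1)) :
    ∃ A : Fin (m + 1) → Module.End ℂ (Laurent (m + 1)),
      A 0 = 1 ∧ (∀ j : Fin m, A j.succ = Tinv s j * A j.castSucc) ∧
      Y q s i = A i * g q * downProd (T s) i := by
  refine ⟨Fin.induction 1 fun j a => Tinv s j * a, rfl, fun j => rfl, ?_⟩
  induction i using Fin.induction with
  | zero => simp [Y, downProd_zero]
  | succ i ih =>
    have h : Y q s i.succ = Tinv s i * Y q s i.castSucc * Tinv s i := rfl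
    rw [h, ih, Fin.val_castSucc, downProd_eq_mul]
    simp only [Fin.induction_succ, mul_assoc, T_mul_Tinv hs, mul_one, Fin.val_succ]

/-- The exponent of `s` by which `T_i` scales when it swaps the neighbouring entries `a`, `b`. -/
def swapSign (a b : ℤ) : ℤ := if a ≤ b then 1 else -1

/-- The exponent of `s` in the eigenvalue of `Y_i` that belongs to the exponent vector `ν`. -/
def eigExp {m : ℕ} (ν : Fin (m + 1) → ℤ) (i : Fin (m + 1)) : ℤ :=
  ∑ j ∈ Finset.Ioi i, swapSign (ν i) (ν j) - ∑ j ∈ Finset.Iio i, swapSign (ν j) (ν i)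

section Chain

variable {m : ℕ} {q s : ℂ}
  {Rel : (Fin (m + 1) → ℤ) → (Fin (m + 1) → ℤ) → Laurent (m + 1) → Prop}

theorem sum_Ioi_castSucc (i : Fin m) (f : Fin (m + 1) → ℤ) :
    ∑ j ∈ Finset.Ioi i.castSucc, f j = f i.succ + ∑ j ∈ Finset.Ioi i.succ, f j := by
  have h : Finset.Ioi i.castSucc = insert i.succ (Finset.Ioi i.succ) := by
    ext j
    simp only [Finset.mem_Ioi, Finset.mem_insert, Fin.lt_def, Fin.ext_iff, Fin.val_succ,
      Fin.val_castSucc]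
    omega
  rw [h, Finset.sum_insert (by simp)]

theorem sum_Iio_succ (i : Fin m) (f : Fin (m + 1) → ℤ) :
    ∑ j ∈ Finset.Iio i.succ, f j = f i.castSucc + ∑ j ∈ Finset.Iio i.castSucc, f j := by
  have h : Finset.Iio i.succ = insert i.castSucc (Finset.Iio i.castSucc) := by
    ext j
    simp only [Finset.mem_Iio, Finset.mem_insert, Fin.lt_def, Fin.ext_iff, Fin.val_succ,
      Fin.val_castSucc]
    omega
  rw [h, Finset.sum_insert (by simp)]

/-- The entry at position `i` travels to the last position and passes each later entry once, which
accounts for the sum of signs. Only comparisons of `π i` with later values of `π` occur on the way.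
-/
theorem rel_downProd (hs : s ≠ 0)
    (hT : ∀ π ν f (i : Fin m), π i.castSucc < π i.succ → Rel π ν f →
      Rel (permVec (simple i) π) (permVec (simple i) ν)
        (s ^ (-swapSign (ν i.castSucc) (ν i.succ)) • T s i f))
    (i : Fin (m + 1)) {π ν : Fin (m + 1) → ℤ} {f : Laurent (m + 1)} (hπ : ∀ j, i < j → π i < π j)
    (h : Rel π ν f) :
    Rel (permVec (downProd simple i) π) (permVec (downProd simple i) ν)
      (s ^ (-∑ j ∈ Finset.Ioi i, swapSign (ν i) (ν j)) • downProd (T s) i f) := by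
  induction i using Fin.reverseInduction generalizing π ν f with
  | last =>
    have : Finset.Ioi (Fin.last m) = ∅ := by ext j; simp [Fin.le_last]
    simpa [downProd_last, permVec_one, this] using h
  | cast i ih =>
    have hlt : i.castSucc < i.succ := Fin.castSucc_lt_succ
    have hne (j : Fin (m + 1)) (hj : i.succ < j) : simple i j = j :=
      simple_of_ne (hlt.trans hj).ne' hj.ne'
    have h2 := ih (fun j hj => by
      rw [permVec_simple_apply, permVec_simple_apply, simple_succ, hne j hj]
      exact hπ j (hlt.trans hj)) (hT π ν f i (hπ _ hlt) h)
    have e : ∑ j ∈ Finset.Ioi i.succ,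
        swapSign (permVec (simple i) ν i.succ) (permVec (simple i) ν j) =
        ∑ j ∈ Finset.Ioi i.succ, swapSign (ν i.castSucc) (ν j) :=
      Finset.sum_congr rfl fun j hj => by
        rw [permVec_simple_apply, permVec_simple_apply, simple_succ, hne j (Finset.mem_Ioi.mp hj)]
    rw [e, map_smul, smul_smul, ← zpow_add₀ hs] at h2
    rw [Fin.val_castSucc, downProd_eq_mul, downProd_eq_mul, permVec_mul, permVec_mul,
      sum_Ioi_castSucc, neg_add_rev, Module.End.mul_apply]
    exact h2

/-- The return journey: the tracked entry starts at the first position and moves right to `i`,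
passing the entries that originally preceded it. The hypothesis concerns the permuted vectors, the
conclusion the original ones. -/
theorem rel_upProd (hs : s ≠ 0)
    (hT : ∀ π ν f (i : Fin m), π i.succ < π i.castSucc → Rel π ν f →
      Rel (permVec (simple i) π) (permVec (simple i) ν)
        (s ^ swapSign (ν i.succ) (ν i.castSucc) • Tinv s i f))
    {A : Fin (m + 1) → Module.End ℂ (Laurent (m + 1))} (h0 : A 0 = 1)
    (hA : ∀ j : Fin m, A j.succ = Tinv s j * A j.castSucc)
    (i : Fin (m + 1)) {π ν : Fin (m + 1) → ℤ} {f : Laurent (m + 1)} (hπ : ∀ j, j < i → π j < π i)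
    (h : Rel (permVec (upProd simple i) π) (permVec (upProd simple i) ν) f) :
    Rel π ν (s ^ (∑ j ∈ Finset.Iio i, swapSign (ν j) (ν i)) • A i f) := by
  induction i using Fin.induction generalizing π ν f with
  | zero =>
    have : Finset.Iio (0 : Fin (m + 1)) = ∅ := by ext j; simp
    simpa [upProd_zero, permVec_one, this, h0] using h
  | succ i ih =>
    have hlt : i.castSucc < i.succ := Fin.castSucc_lt_succ
    have hne (j : Fin (m + 1)) (hj : j < i.castSucc) : simple i j = j :=
      simple_of_ne hj.ne (hj.trans hlt).ne
    rw [Fin.val_succ, upProd_succ, permVec_mul, permVec_mul] at h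
    have h2 := ih (fun j hj => by
      rw [permVec_simple_apply, permVec_simple_apply, simple_castSucc, hne j hj]
      exact hπ j (hj.trans hlt)) h
    have h3 := hT _ _ _ i (by
      rw [permVec_simple_apply, permVec_simple_apply, simple_castSucc, simple_succ]
      exact hπ _ hlt) h2
    have e : ∑ j ∈ Finset.Iio i.castSucc,
        swapSign (permVec (simple i) ν j) (permVec (simple i) ν i.castSucc) =
        ∑ j ∈ Finset.Iio i.castSucc, swapSign (ν j) (ν i.succ) :=
      Finset.sum_congr rfl fun j hj => by
        rw [permVec_simple_apply, permVec_simple_apply, simple_castSucc,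
          hne j (Finset.mem_Iio.mp hj)]
    rw [e, map_smul, smul_smul, ← zpow_add₀ hs, permVec_simple_simple, permVec_simple_simple,
      permVec_simple_apply, permVec_simple_apply, simple_castSucc, simple_succ] at h3
    rw [sum_Iio_succ, hA]
    exact h3

/-- A relation between exponent vectors and Laurent polynomials which is stable under the `T_i`,
their inverses and `g`, up to the expected scalars, is stable under the `Y_i`. The auxiliary weight
`π` records which of the two operators `T_i` and `T_i⁻¹` may be applied. -/
theorem rel_Y (hs : s ≠ 0)
    (hT : ∀ π ν f (i : Fin m), π i.castSucc < π i.succ → Rel π ν f →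
      Rel (permVec (simple i) π) (permVec (simple i) ν)
        (s ^ (-swapSign (ν i.castSucc) (ν i.succ)) • T s i f))
    (hTinv : ∀ π ν f (i : Fin m), π i.succ < π i.castSucc → Rel π ν f →
      Rel (permVec (simple i) π) (permVec (simple i) ν)
        (s ^ swapSign (ν i.succ) (ν i.castSucc) • Tinv s i f))
    (hg : ∀ π ν f, Rel π ν f → Rel (permVec (rotation m) π) (permVec (rotation m) ν)
      (q ^ ν (Fin.last m) • g q f))
    {π ν : Fin (m + 1) → ℤ} {f : Laurent (m + 1)} (hπ : StrictMono π) (h : Rel π ν f)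
    (i : Fin (m + 1)) : Rel π ν ((q ^ ν i * s ^ (-eigExp ν i)) • Y q s i f) := by
  obtain ⟨A, h0, hA, hY⟩ := Y_eq (q := q) hs i
  have h1 := hg _ _ _ (rel_downProd hs hT i (fun j hj => hπ hj) h)
  -- The tracked entry is in the last position when `g` acts, hence the factor `q ^ ν i`; the
  -- permutation reached is the one that the inverse operators undo.
  rw [← permVec_mul, ← permVec_mul, rotation_mul_downProd, permVec_downProd_last] at h1
  have h2 := rel_upProd hs hTinv h0 hA i (fun j hj => hπ hj) h1
  rw [hY]
  simp only [map_smul, smul_smul, Module.End.mul_apply] at h2 ⊢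
  convert h2 using 2
  rw [eigExp, neg_sub, sub_eq_add_neg, zpow_add₀ hs]
  ring

end Chain

open scoped Matrix

/-! ### Triangularity -/

theorem T_mono {m : ℕ} (s : ℂ) (i : Fin m) (κ : Fin (m + 1) → ℤ) :
    T s i (mono κ) = s⁻¹ • (s ^ 2 • mono κ -
      (s ^ 2 • (x i.castSucc * divDiffMono i κ) - x i.succ * divDiffMono i κ)) := by
  simp [T, divDiff_mono, sub_mul]

theorem T_mono_of_eq {m : ℕ} {s : ℂ} (hs : s ≠ 0) {i : Fin m} {κ : Fin (m + 1) → ℤ}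
    (h : κ i.castSucc = κ i.succ) : T s i (mono κ) = s • mono κ := by
  rw [T_mono, divDiffMono, if_pos h.ge]
  simp only [h, sub_self, Int.toNat_zero, Finset.range_zero, Finset.sum_empty, mul_zero, smul_zero,
    sub_zero, smul_smul]
  congr 1
  field_simp

/-- Multiplying the divided difference by `x_i` and by `x_{i+1}` gives two strings of monomials
offset by one. They overlap in the interior of the string from `κ` to `s_i κ`; at the ends, `κ`
cancels and `s_i κ` survives. -/
theorem T_mono_of_gt {m : ℕ} (s : ℂ) {i : Fin m} {κ : Fin (m + 1) → ℤ} {d : ℕ}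
    (h : κ i.castSucc - κ i.succ = d + 1) :
    T s i (mono κ) = s⁻¹ • (mono (permVec (simple i) κ) + (1 - s ^ 2) •
      ∑ k ∈ Finset.range d,
        mono (κ + (-((k : ℤ) + 1)) • (eps i.castSucc - eps i.succ))) := by
  rw [T_mono, divDiffMono, if_pos (by omega), Finset.mul_sum, Finset.mul_sum, permVec_simple, h,
    show ((d : ℤ) + 1).toNat = d + 1 by omega]
  have h1 : ∀ k ∈ Finset.range (d + 1), x i.castSucc *
      mono (κ - ((k : ℤ) + 1) • eps i.castSucc + (k : ℤ) • eps i.succ) =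
      mono (κ + (-(k : ℤ)) • (eps i.castSucc - eps i.succ)) := fun k _ => by
    rw [x, mono_mul]; congr 1; module
  have h2 : ∀ k ∈ Finset.range (d + 1), x i.succ *
      mono (κ - ((k : ℤ) + 1) • eps i.castSucc + (k : ℤ) • eps i.succ) =
      mono (κ + (-((k : ℤ) + 1)) • (eps i.castSucc - eps i.succ)) := fun k _ => by
    rw [x, mono_mul]; congr 1; module
  rw [Finset.sum_congr rfl h1, Finset.sum_congr rfl h2, Finset.sum_range_succ',
    Finset.sum_range_succ]
  have h3 : κ - ((d : ℤ) + 1) • eps i.castSucc + ((d : ℤ) + 1) • eps i.succ =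
      κ + (-((d : ℤ) + 1)) • (eps i.castSucc - eps i.succ) := by module
  rw [h3]
  push_cast
  simp only [neg_zero, zero_smul, add_zero]
  module

/-- The same overlap of strings, but for an ascent `x^κ` itself survives too. -/
theorem T_mono_of_lt {m : ℕ} (s : ℂ) {i : Fin m} {κ : Fin (m + 1) → ℤ} {d : ℕ}
    (h : κ i.succ - κ i.castSucc = d + 1) :
    T s i (mono κ) = s⁻¹ • (s ^ 2 • mono (permVec (simple i) κ) + (s ^ 2 - 1) • mono κ +
      (s ^ 2 - 1) • ∑ k ∈ Finset.range d,
        mono (κ + ((k : ℤ) + 1) • (eps i.castSucc - eps i.succ))) := by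
  rw [T_mono, divDiffMono, if_neg (by omega), mul_neg, mul_neg, Finset.mul_sum, Finset.mul_sum,
    permVec_simple, show κ i.castSucc - κ i.succ = -((d : ℤ) + 1) by omega, h,
    show ((d : ℤ) + 1).toNat = d + 1 by omega]
  have h1 : ∀ k ∈ Finset.range (d + 1), x i.castSucc *
      mono (κ + (k : ℤ) • eps i.castSucc - ((k : ℤ) + 1) • eps i.succ) =
      mono (κ + ((k : ℤ) + 1) • (eps i.castSucc - eps i.succ)) := fun k _ => by
    rw [x, mono_mul]; congr 1; module
  have h2 : ∀ k ∈ Finset.range (d + 1), x i.succ *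
      mono (κ + (k : ℤ) • eps i.castSucc - ((k : ℤ) + 1) • eps i.succ) =
      mono (κ + (k : ℤ) • (eps i.castSucc - eps i.succ)) := fun k _ => by
    rw [x, mono_mul]; congr 1; module
  rw [Finset.sum_congr rfl h1, Finset.sum_congr rfl h2, Finset.sum_range_succ,
    Finset.sum_range_succ' _ d]
  have h3 : κ - (-((d : ℤ) + 1)) • eps i.castSucc + (-((d : ℤ) + 1)) • eps i.succ =
      κ + ((d : ℤ) + 1) • (eps i.castSucc - eps i.succ) := by module
  rw [h3]
  push_cast
  simp only [zero_smul, add_zero]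
  module

/-! ### The order on exponent vectors by norm and weight -/

theorem permVec_dotProduct {n : ℕ} (w : Equiv.Perm (Fin n)) (μ ν : Fin n → ℤ) :
    permVec w μ ⬝ᵥ permVec w ν = μ ⬝ᵥ ν := by
  simp only [dotProduct, permVec_apply]
  exact Equiv.sum_comp w⁻¹ fun i => μ i * ν i

theorem dotProduct_add_root {m : ℕ} (i : Fin m) (π κ : Fin (m + 1) → ℤ) (c : ℤ) :
    π ⬝ᵥ (κ + c • (eps i.castSucc - eps i.succ)) =
      π ⬝ᵥ κ + c * (π i.castSucc - π i.succ) := by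
  rw [dotProduct_add, dotProduct_smul, dotProduct_sub]
  simp [eps]

/-- The increment is negative exactly when the vector lies strictly between `κ` and `s_i κ` on its
root string; interior terms therefore have smaller norm. -/
theorem sq_norm_add_root {m : ℕ} (i : Fin m) (κ : Fin (m + 1) → ℤ) (c : ℤ) :
    (κ + c • (eps i.castSucc - eps i.succ)) ⬝ᵥ (κ + c • (eps i.castSucc - eps i.succ)) =
      κ ⬝ᵥ κ + 2 * c * (κ i.castSucc - κ i.succ + c) := by
  have h6 : i.succ ≠ i.castSucc := (Fin.castSucc_lt_succ (i := i)).ne'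
  rw [dotProduct_add_root, dotProduct_comm, dotProduct_add_root]
  simp [eps, h6, h6.symm]
  ring

/-- The exponent vectors below `(N, M)` in the order defined by the norm and the weight `π`. -/
def lowSet {n : ℕ} (π : Fin n → ℤ) (N M : ℤ) : Set (Fin n → ℤ) :=
  {ν | ν ⬝ᵥ ν < N ∨ ν ⬝ᵥ ν = N ∧ π ⬝ᵥ ν < M}

/-- The span of the monomials below `(N, M)`. -/
def low {n : ℕ} (π : Fin n → ℤ) (N M : ℤ) : Submodule ℂ (Laurent n) :=
  Submodule.span ℂ (mono '' lowSet π N M)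

theorem mono_mem_low {n : ℕ} {π : Fin n → ℤ} {N M : ℤ} {ν : Fin n → ℤ} (h : ν ∈ lowSet π N M) :
    mono ν ∈ low π N M :=
  Submodule.subset_span ⟨ν, h, rfl⟩

theorem low_mono {n : ℕ} {π ν : Fin n → ℤ} {N M : ℤ} (h : ν ∈ lowSet π N M) :
    low π (ν ⬝ᵥ ν) (π ⬝ᵥ ν) ≤ low π N M := by
  refine Submodule.span_mono (Set.image_mono fun κ hκ => ?_)
  rcases h with h | ⟨h, h'⟩ <;> rcases hκ with hκ | ⟨hκ, hκ'⟩
  · exact Or.inl (hκ.trans h)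
  · exact Or.inl (hκ.trans_lt h)
  · exact Or.inl (hκ.trans_eq h)
  · exact Or.inr ⟨hκ.trans h, hκ'.trans h'⟩

theorem coeff_of_mem_low {n : ℕ} {π : Fin n → ℤ} {N M : ℤ} {f : Laurent n} (hf : f ∈ low π N M)
    {ν : Fin n → ℤ} (h : ν ∉ lowSet π N M) : f.coeff ν = 0 := by
  induction hf using Submodule.span_induction with
  | mem f hf =>
    obtain ⟨κ, hκ, rfl⟩ := hf
    have : κ ≠ ν := fun e => h (e ▸ hκ)
    simp [mono, this]
  | zero => simp
  | add f g _ _ hf hg => simp [hf, hg]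
  | smul c f _ hf => simp [hf]

theorem permVec_mem_lowSet {n : ℕ} {π : Fin n → ℤ} {N M : ℤ} {ν : Fin n → ℤ}
    (w : Equiv.Perm (Fin n)) : permVec w ν ∈ lowSet (permVec w π) N M ↔ ν ∈ lowSet π N M := by
  simp [lowSet, permVec_dotProduct]

theorem sum_mem_low {m : ℕ} (i : Fin m) (π κ : Fin (m + 1) → ℤ) (M : ℤ) {d : ℕ} (c : ℕ → ℤ)
    (h : ∀ k < d, 2 * c k * (κ i.castSucc - κ i.succ + c k) < 0) :
    ∑ k ∈ Finset.range d, mono (κ + c k • (eps i.castSucc - eps i.succ)) ∈ low π (κ ⬝ᵥ κ) M := by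
  refine Submodule.sum_mem _ fun k hk => mono_mem_low (Or.inl ?_)
  rw [sq_norm_add_root]
  linarith [h k (Finset.mem_range.mp hk)]

theorem mem_lowSet_simple {m : ℕ} {i : Fin m} {π ν : Fin (m + 1) → ℤ}
    (h : (π i.succ - π i.castSucc) * (ν i.castSucc - ν i.succ) < 0) :
    ν ∈ lowSet (permVec (simple i) π) (ν ⬝ᵥ ν) (π ⬝ᵥ ν) := by
  refine Or.inr ⟨rfl, ?_⟩
  have h1 : permVec (simple i) π = π + (-(π i.castSucc - π i.succ)) •
      (eps i.castSucc - eps i.succ) := by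
    rw [permVec_simple]; module
  rw [h1, dotProduct_comm, dotProduct_add_root, dotProduct_comm]
  linarith

/-- Interior terms of the string drop in norm. The only other unwanted term is `x^ν`, which appears
when `ν` ascends at `i`; it has the norm of `s_i ν`, and the condition on `π` makes its weight
smaller. -/
theorem T_mono_sub_mem {m : ℕ} {s : ℂ} (hs : s ≠ 0) {i : Fin m} {π ν : Fin (m + 1) → ℤ}
    (hπ : π i.castSucc < π i.succ) :
    T s i (mono ν) - s ^ swapSign (ν i.castSucc) (ν i.succ) • mono (permVec (simple i) ν) ∈
      low (permVec (simple i) π) (ν ⬝ᵥ ν) (π ⬝ᵥ ν) := by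
  rcases lt_trichotomy (ν i.castSucc) (ν i.succ) with h | h | h
  · obtain ⟨d, hd⟩ : ∃ d : ℕ, ν i.succ - ν i.castSucc = d + 1 :=
      ⟨(ν i.succ - ν i.castSucc).toNat - 1, by omega⟩
    have h1 := sum_mem_low i (permVec (simple i) π) ν (π ⬝ᵥ ν) (d := d) (fun k => (k : ℤ) + 1)
      fun k hk => by
        have : (k : ℤ) + 1 ≤ d := by exact_mod_cast hk
        nlinarith
    have h2 := mono_mem_low (mem_lowSet_simple (i := i) (π := π) (ν := ν) (by nlinarith))
    have e : T s i (mono ν) - s ^ swapSign (ν i.castSucc) (ν i.succ) •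
        mono (permVec (simple i) ν) = (s⁻¹ * (s ^ 2 - 1)) • mono ν + (s⁻¹ * (s ^ 2 - 1)) •
        ∑ k ∈ Finset.range d, mono (ν + ((k : ℤ) + 1) • (eps i.castSucc - eps i.succ)) := by
      rw [T_mono_of_lt s hd, swapSign, if_pos h.le, zpow_one]
      match_scalars <;> field_simp
      ring
    rw [e]
    exact Submodule.add_mem _ (Submodule.smul_mem _ _ h2) (Submodule.smul_mem _ _ h1)
  · have e : permVec (simple i) ν = ν := by rw [permVec_simple, h]; simp
    rw [T_mono_of_eq hs h, swapSign, if_pos h.le, e, zpow_one, sub_self]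
    exact Submodule.zero_mem _
  · obtain ⟨d, hd⟩ : ∃ d : ℕ, ν i.castSucc - ν i.succ = d + 1 :=
      ⟨(ν i.castSucc - ν i.succ).toNat - 1, by omega⟩
    have h1 := sum_mem_low i (permVec (simple i) π) ν (π ⬝ᵥ ν) (d := d) (fun k => -((k : ℤ) + 1))
      fun k hk => by
        have : (k : ℤ) + 1 ≤ d := by exact_mod_cast hk
        nlinarith
    have e : T s i (mono ν) - s ^ swapSign (ν i.castSucc) (ν i.succ) •
        mono (permVec (simple i) ν) = (s⁻¹ * (1 - s ^ 2)) •
        ∑ k ∈ Finset.range d, mono (ν + (-((k : ℤ) + 1)) • (eps i.castSucc - eps i.succ)) := by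
      rw [T_mono_of_gt s hd, swapSign, if_neg h.not_ge, zpow_neg_one]
      module
    rw [e]
    exact Submodule.smul_mem _ _ h1

/-- Subtracting `(s - s⁻¹) x^ν` from `T_i x^ν` removes the term `x^ν` at an ascent and creates one
at a descent. The two cases thus change roles, and so does the inequality for `π`. -/
theorem Tinv_mono_sub_mem {m : ℕ} {s : ℂ} (hs : s ≠ 0) {i : Fin m} {π ν : Fin (m + 1) → ℤ}
    (hπ : π i.succ < π i.castSucc) :
    Tinv s i (mono ν) - s ^ (-swapSign (ν i.succ) (ν i.castSucc)) • mono (permVec (simple i) ν) ∈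
      low (permVec (simple i) π) (ν ⬝ᵥ ν) (π ⬝ᵥ ν) := by
  have e0 : Tinv s i (mono ν) = T s i (mono ν) - (s - s⁻¹) • mono ν := by simp [Tinv]
  rcases lt_trichotomy (ν i.castSucc) (ν i.succ) with h | h | h
  · obtain ⟨d, hd⟩ : ∃ d : ℕ, ν i.succ - ν i.castSucc = d + 1 :=
      ⟨(ν i.succ - ν i.castSucc).toNat - 1, by omega⟩
    have h1 := sum_mem_low i (permVec (simple i) π) ν (π ⬝ᵥ ν) (d := d) (fun k => (k : ℤ) + 1)
      fun k hk => by
        have : (k : ℤ) + 1 ≤ d := by exact_mod_cast hk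
        nlinarith
    have e : Tinv s i (mono ν) - s ^ (-swapSign (ν i.succ) (ν i.castSucc)) •
        mono (permVec (simple i) ν) = (s⁻¹ * (s ^ 2 - 1)) •
        ∑ k ∈ Finset.range d, mono (ν + ((k : ℤ) + 1) • (eps i.castSucc - eps i.succ)) := by
      rw [e0, T_mono_of_lt s hd, swapSign, if_neg h.not_ge, neg_neg, zpow_one]
      match_scalars <;> field_simp <;> ring
    rw [e]
    exact Submodule.smul_mem _ _ h1
  · have e : permVec (simple i) ν = ν := by rw [permVec_simple, h]; simp
    rw [e0, T_mono_of_eq hs h, swapSign, if_pos h.ge, e, zpow_neg_one, ← sub_smul, ← sub_smul,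
      sub_sub_cancel, sub_self, zero_smul]
    exact Submodule.zero_mem _
  · obtain ⟨d, hd⟩ : ∃ d : ℕ, ν i.castSucc - ν i.succ = d + 1 :=
      ⟨(ν i.castSucc - ν i.succ).toNat - 1, by omega⟩
    have h1 := sum_mem_low i (permVec (simple i) π) ν (π ⬝ᵥ ν) (d := d) (fun k => -((k : ℤ) + 1))
      fun k hk => by
        have : (k : ℤ) + 1 ≤ d := by exact_mod_cast hk
        nlinarith
    have h2 := mono_mem_low (mem_lowSet_simple (i := i) (π := π) (ν := ν) (by nlinarith))
    have e : Tinv s i (mono ν) - s ^ (-swapSign (ν i.succ) (ν i.castSucc)) •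
        mono (permVec (simple i) ν) = (-(s - s⁻¹)) • mono ν + (s⁻¹ * (1 - s ^ 2)) •
        ∑ k ∈ Finset.range d, mono (ν + (-((k : ℤ) + 1)) • (eps i.castSucc - eps i.succ)) := by
      rw [e0, T_mono_of_gt s hd, swapSign, if_pos h.le, zpow_neg_one]
      module
    rw [e]
    exact Submodule.add_mem _ (Submodule.smul_mem _ _ h2) (Submodule.smul_mem _ _ h1)

theorem map_mem_low {n : ℕ} {φ : Module.End ℂ (Laurent n)} {w : Equiv.Perm (Fin n)}
    {π : Fin n → ℤ} {c : (Fin n → ℤ) → ℂ}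
    (h : ∀ ν, φ (mono ν) - c ν • mono (permVec w ν) ∈ low (permVec w π) (ν ⬝ᵥ ν) (π ⬝ᵥ ν))
    {N M : ℤ} {f : Laurent n} (hf : f ∈ low π N M) : φ f ∈ low (permVec w π) N M := by
  induction hf using Submodule.span_induction with
  | mem f hf =>
    obtain ⟨ν, hν, rfl⟩ := hf
    have h' := permVec_mem_lowSet (N := N) (M := M) w |>.mpr hν
    have h1 := low_mono h'
    rw [permVec_dotProduct, permVec_dotProduct] at h1
    have h2 := Submodule.add_mem _ (h1 (h ν)) (Submodule.smul_mem _ (c ν) (mono_mem_low h'))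
    rwa [sub_add_cancel] at h2
  | zero => simp
  | add f g _ _ hf hg => rw [map_add]; exact Submodule.add_mem _ hf hg
  | smul c f _ hf => rw [map_smul]; exact Submodule.smul_mem _ _ hf

/-- `f` has the leading monomial `ν` with the coefficient `1`, of the norm `N` and the weight
`M`. -/
def IsLeading {n : ℕ} (N M : ℤ) (π ν : Fin n → ℤ) (f : Laurent n) : Prop :=
  ν ⬝ᵥ ν = N ∧ π ⬝ᵥ ν = M ∧ f - mono ν ∈ low π N M

theorem IsLeading.map {n : ℕ} {φ : Module.End ℂ (Laurent n)} {w : Equiv.Perm (Fin n)}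
    {π : Fin n → ℤ} {c : (Fin n → ℤ) → ℂ} (hc : ∀ ν, c ν ≠ 0)
    (h : ∀ ν, φ (mono ν) - c ν • mono (permVec w ν) ∈ low (permVec w π) (ν ⬝ᵥ ν) (π ⬝ᵥ ν))
    {N M : ℤ} {ν : Fin n → ℤ} {f : Laurent n} (hf : IsLeading N M π ν f) :
    IsLeading N M (permVec w π) (permVec w ν) ((c ν)⁻¹ • φ f) := by
  obtain ⟨rfl, rfl, h3⟩ := hf
  refine ⟨permVec_dotProduct _ _ _, permVec_dotProduct _ _ _, ?_⟩
  have h4 := Submodule.smul_mem _ (c ν)⁻¹ (Submodule.add_mem _ (map_mem_low h h3) (h ν))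
  rw [map_sub, sub_add_sub_cancel, smul_sub, smul_smul, inv_mul_cancel₀ (hc ν), one_smul] at h4
  exact h4

/-- This is `rel_Y` for the relation of having a given leading monomial. Norm and weight stay
constant along the path because `π` and `ν` are permuted simultaneously. -/
theorem Y_mono_sub_mem {m : ℕ} {q s : ℂ} (hq : q ≠ 0) (hs : s ≠ 0) {π : Fin (m + 1) → ℤ}
    (hπ : StrictMono π) (i : Fin (m + 1)) (ν : Fin (m + 1) → ℤ) :
    Y q s i (mono ν) - (q ^ (-ν i) * s ^ eigExp ν i) • mono ν ∈ low π (ν ⬝ᵥ ν) (π ⬝ᵥ ν) := by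
  have h := rel_Y (q := q) (Rel := IsLeading (ν ⬝ᵥ ν) (π ⬝ᵥ ν)) hs
    (fun π ν f i hπ hf => by
      have := hf.map (fun ν => zpow_ne_zero _ hs) (fun ν => T_mono_sub_mem hs (ν := ν) hπ)
      rwa [← zpow_neg] at this)
    (fun π ν f i hπ hf => by
      have := hf.map (fun ν => zpow_ne_zero _ hs) (fun ν => Tinv_mono_sub_mem hs (ν := ν) hπ)
      rwa [← zpow_neg, neg_neg] at this)
    (fun π ν f hf => by
      have := hf.map (φ := g q) (w := rotation m) (c := fun ν => q ^ (-ν (Fin.last m)))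
        (fun ν => zpow_ne_zero _ hq)
        (fun ν => by rw [g_mono, sub_self]; exact Submodule.zero_mem _)
      rwa [← zpow_neg, neg_neg] at this)
    hπ (f := mono ν) (ν := ν) ⟨rfl, rfl, by rw [sub_self]; exact Submodule.zero_mem _⟩ i
  have h2 := Submodule.smul_mem _ (q ^ (-ν i) * s ^ eigExp ν i) h.2.2
  rw [smul_sub, smul_smul] at h2
  have e : q ^ (-ν i) * s ^ eigExp ν i * (q ^ ν i * s ^ (-eigExp ν i)) = 1 := by
    rw [zpow_neg, zpow_neg]
    have := zpow_ne_zero (ν i) hq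
    have := zpow_ne_zero (eigExp ν i) hs
    field_simp
  rwa [e, one_smul] at h2

theorem eq_sum_mono {n : ℕ} (f : Laurent n) :
    f = ∑ ν ∈ f.coeff.support, f.coeff ν • mono ν := by
  ext κ
  simp [mono, Finsupp.single_apply, AddMonoidAlgebra.coeff_sum]

/-- A nonzero joint eigenvector of the `Y_i` has the eigenvalues that belong to one of its
exponent vectors. -/
theorem exists_eigenvalue {m : ℕ} {q s : ℂ} (hq : q ≠ 0) (hs : s ≠ 0) {f : Laurent (m + 1)}
    (hf : f ≠ 0) {c : Fin (m + 1) → ℂ} (h : ∀ i, Y q s i f = c i • f) :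
    ∃ ν, f.coeff ν ≠ 0 ∧ ∀ i, c i = q ^ (-ν i) * s ^ eigExp ν i := by
  let π : Fin (m + 1) → ℤ := fun i => (i : ℕ)
  have hπ : StrictMono π := fun i j hij => by simpa [π] using hij
  have hne : f.coeff.support.Nonempty := by
    rw [Finsupp.support_nonempty_iff]
    intro h0
    exact hf (by ext; simp [h0])
  -- A maximal exponent is not below any other exponent of `f`, so no `x^κ` with `κ ≠ ν` contributes
  -- to the coefficient of `x^ν` in `Y_i f`. Ties are harmless, since being lower is strict.
  obtain ⟨ν, hν, hmax⟩ := Finset.exists_max_image f.coeff.support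
    (fun ν => toLex (ν ⬝ᵥ ν, π ⬝ᵥ ν)) hne
  refine ⟨ν, Finsupp.mem_support_iff.mp hν, fun i => ?_⟩
  have hout (κ) (hκ : κ ∈ f.coeff.support) : ν ∉ lowSet π (κ ⬝ᵥ κ) (π ⬝ᵥ κ) := by
    intro h1
    have h2 := hmax κ hκ
    rw [Prod.Lex.toLex_le_toLex] at h2
    rcases h1 with h1 | h1 <;> rcases h2 with h2 | h2 <;> simp at h2 <;> omega
  have h1 := congrArg (fun f : Laurent (m + 1) => f.coeff ν) (h i)
  have h2 : (Y q s i f).coeff ν = (q ^ (-ν i) * s ^ eigExp ν i) * f.coeff ν := by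
    have h3 (κ) (hκ : κ ∈ f.coeff.support) : (f.coeff κ • Y q s i (mono κ)).coeff ν =
        if κ = ν then (q ^ (-ν i) * s ^ eigExp ν i) * f.coeff ν else 0 := by
      have h4 := coeff_of_mem_low (Y_mono_sub_mem (q := q) hq hs hπ i κ) (hout κ hκ)
      rw [AddMonoidAlgebra.coeff_sub, Finsupp.sub_apply, sub_eq_zero] at h4
      rw [AddMonoidAlgebra.coeff_smul, Finsupp.smul_apply, h4]
      split_ifs with h5
      · subst h5
        simp [mono, mul_comm]
      · simp [mono, h5]
    conv_lhs => rw [eq_sum_mono f]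
    rw [map_sum, AddMonoidAlgebra.coeff_sum, Finsupp.finsetSum_apply]
    simp only [map_smul]
    rw [Finset.sum_congr rfl h3, Finset.sum_ite_eq', if_pos hν]
  rw [h2, AddMonoidAlgebra.coeff_smul, Finsupp.smul_apply, smul_eq_mul] at h1
  exact (mul_right_cancel₀ (Finsupp.mem_support_iff.mp hν) h1).symm

/-! ### The eigenvalues -/

theorem exists_isMinLength {n : ℕ} {S : Set (Equiv.Perm (Fin n))} (hS : S.Nonempty) :
    ∃ w, IsMinLength S w := by
  obtain ⟨w, hw, h⟩ := S.toFinite.toFinset.exists_min_image length (by simpa using hS)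
  exact ⟨w, by simpa using hw, fun u hu => h u (by simpa using hu)⟩

theorem permVec_apply_apply {n : ℕ} (w : Equiv.Perm (Fin n)) (μ : Fin n → ℤ) (i : Fin n) :
    permVec w μ (w i) = μ i := by
  simp [permVec_apply]

/-- Minimal length forces stable sorting: an inversion of the stable sort `σ` is a strict descent of
`μ`, hence an inversion of every sorting permutation. A sorting permutation of minimal length then
has no other inversions, so it preserves the order of equal entries. -/
theorem sortPerm_lt_iff {n : ℕ} (μ : Fin n → ℤ) (i j : Fin n) :
    sortPerm μ i < sortPerm μ j ↔ μ i < μ j ∨ μ i = μ j ∧ i < j := by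
  have hσ := (Tuple.eq_sort_iff (f := μ) (σ := Tuple.sort μ)).mp rfl
  set σ := (Tuple.sort μ)⁻¹ with hσdef
  have hσmono : Monotone (permVec σ μ) := by
    convert hσ.1 using 1
    ext k
    simp [permVec_apply, hσdef]
  have hw : IsMinLength {w | Monotone (permVec w μ)} (sortPerm μ) :=
    Classical.epsilon_spec (exists_isMinLength ⟨σ, hσmono⟩)
  set w := sortPerm μ
  have hlt {u : Equiv.Perm (Fin n)} (hu : Monotone (permVec u μ)) {i j : Fin n}
      (h : μ i < μ j) : u i < u j := by
    by_contra h'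
    have := hu (not_lt.mp h')
    rw [permVec_apply_apply, permVec_apply_apply] at this
    omega
  have hσst {i j : Fin n} (hij : i < j) (h : μ i = μ j) : σ i < σ j := by
    by_contra h'
    have h1 : σ j < σ i := lt_of_le_of_ne (not_lt.mp h') fun e => hij.ne' (σ.injective e)
    have h2 := hσ.2 (σ j) (σ i) h1
    have e (k) : Tuple.sort μ (σ k) = k := by simp [hσdef]
    rw [e, e] at h2
    exact (h2 h.symm).not_gt hij
  have hsub : (Finset.univ.filter fun p : Fin n × Fin n => p.1 < p.2 ∧ σ p.2 < σ p.1) ⊆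
      Finset.univ.filter fun p : Fin n × Fin n => p.1 < p.2 ∧ w p.2 < w p.1 := by
    intro p hp
    simp only [Finset.mem_filter, Finset.mem_univ, true_and] at hp ⊢
    refine ⟨hp.1, hlt hw.1 ?_⟩
    by_contra h
    rcases (not_lt.mp h).lt_or_eq with h | h
    · exact (hlt hσmono h).not_gt hp.2
    · exact (hσst hp.1 h).not_gt hp.2
  -- The inclusion of inversion sets and the minimality of `w` make the two sets equal.
  have heq := Finset.eq_of_subset_of_card_le hsub (hw.2 σ hσmono)
  have hst {i j : Fin n} (hij : i < j) (h : μ i = μ j) : w i < w j := by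
    by_contra h'
    have h1 : w j < w i := lt_of_le_of_ne (not_lt.mp h') fun e => hij.ne' (w.injective e)
    have h2 : (i, j) ∈ Finset.univ.filter fun p : Fin n × Fin n => p.1 < p.2 ∧ w p.2 < w p.1 := by
      simp [hij, h1]
    rw [← heq] at h2
    simp only [Finset.mem_filter, Finset.mem_univ, true_and] at h2
    exact (hσst hij h).not_gt h2.2
  constructor
  · intro h
    rcases lt_trichotomy (μ i) (μ j) with h1 | h1 | h1
    · exact Or.inl h1
    · refine Or.inr ⟨h1, ?_⟩
      by_contra h2
      rcases (not_lt.mp h2).lt_or_eq with h2 | h2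
      · exact (hst h2 h1.symm).not_gt h
      · exact h.ne (by rw [h2])
    · exact absurd h (hlt hw.1 h1).not_gt
  · rintro (h | ⟨h, h'⟩)
    · exact hlt hw.1 h
    · exact hst h' h

theorem card_filter_perm_lt {n : ℕ} (w : Equiv.Perm (Fin n)) (i : Fin n) :
    (Finset.univ.filter fun j => w j < w i).card = w i := by
  rw [← Fin.card_Iio (w i)]
  refine Finset.card_bij (fun j _ => w j) (by simp) (fun a _ b _ h => w.injective h) fun b hb => ?_
  exact ⟨w⁻¹ b, by simpa using hb, by simp⟩

/-- Every `j ≠ i` contributes `1 - 2[v(j) < v(i)]`, on either side of `i`: counting ties as `+1` in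
`swapSign` matches the stable order of `v`. The number of `j` with `v(j) < v(i)` is `v(i)`. -/
theorem eigExp_eq {m : ℕ} (μ : Fin (m + 1) → ℤ) (i : Fin (m + 1)) :
    eigExp μ i = -2 * ((sortPerm μ i : ℕ) : ℤ) + m := by
  have h1 (j) (hj : j ∈ Finset.Ioi i) : swapSign (μ i) (μ j) =
      1 - 2 * if sortPerm μ j < sortPerm μ i then 1 else 0 := by
    have hj := Finset.mem_Ioi.mp hj
    simp only [swapSign, sortPerm_lt_iff, hj.not_gt, and_false, or_false]
    split_ifs <;> omega
  have h2 (j) (hj : j ∈ Finset.Iio i) : swapSign (μ j) (μ i) =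
      -(1 - 2 * if sortPerm μ j < sortPerm μ i then 1 else 0) := by
    have hj := Finset.mem_Iio.mp hj
    simp only [swapSign, sortPerm_lt_iff, hj, and_true]
    split_ifs <;> omega
  rw [eigExp, Finset.sum_congr rfl h1, Finset.sum_congr rfl h2, Finset.sum_neg_distrib,
    sub_neg_eq_add]
  have h3 := card_filter_perm_lt (sortPerm μ) i
  have h4 : Finset.univ = insert i (Finset.Ioi i ∪ Finset.Iio i) := by
    ext j
    simp only [Finset.mem_univ, Finset.mem_insert, Finset.mem_union, Finset.mem_Ioi,
      Finset.mem_Iio, true_iff]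
    omega
  have h5 : Disjoint (Finset.Ioi i) (Finset.Iio i) :=
    Finset.disjoint_left.mpr fun j hj hj' => by simp at hj hj'; omega
  have h6 : ∑ j, (1 - 2 * if sortPerm μ j < sortPerm μ i then 1 else 0 : ℤ) =
      (m + 1) - 2 * (sortPerm μ i : ℕ) := by
    rw [Finset.sum_sub_distrib, ← Finset.mul_sum, ← h3, Finset.card_filter]
    simp
  rw [h4, Finset.sum_insert (by simp), Finset.sum_union h5] at h6
  simp only [lt_irrefl, if_false] at h6
  linarith

/-- At an index where `μ` exceeds `ν`, equal eigenvalues give `q^a t^b = 1` with `a = μ i - ν i ≥ 1`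
and `b = v_μ(i) - v_ν(i)`. Genericity excludes `b ≥ 0` only, so negative `b` needs the minimal
choice of the index. -/
theorem eigenvalue_le {m : ℕ} {q s : ℂ} (hq : q ≠ 0) (hs : s ≠ 0)
    (hgen : ∀ a b : ℕ, 1 ≤ a → b ≤ m → q ^ a * (s ^ 2) ^ b ≠ 1) {μ ν : Fin (m + 1) → ℤ}
    (h : ∀ i, q ^ (-μ i) * s ^ eigExp μ i = q ^ (-ν i) * s ^ eigExp ν i) : μ ≤ ν := by
  by_contra hle
  have hne : (Finset.univ.filter fun i => ν i < μ i).Nonempty := by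
    simp only [Pi.le_def, not_forall, not_le] at hle
    obtain ⟨i, hi⟩ := hle
    exact ⟨i, by simpa using hi⟩
  obtain ⟨i, hi, hmin⟩ := Finset.exists_min_image _ (sortPerm ν) hne
  simp only [Finset.mem_filter, Finset.mem_univ, true_and] at hi hmin
  have hlt : sortPerm μ i < sortPerm ν i := by
    by_contra hge
    have hge : (sortPerm ν i : ℕ) ≤ sortPerm μ i := not_lt.mp hge
    refine hgen (μ i - ν i).toNat (sortPerm μ i - sortPerm ν i) (by omega) (by omega) ?_
    have h1 := h i
    rw [eigExp_eq, eigExp_eq] at h1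
    rw [← zpow_natCast q, ← pow_mul, ← zpow_natCast s, Int.toNat_of_nonneg (by omega)]
    push_cast [Nat.cast_sub hge]
    have e1 : q ^ (μ i - ν i) = q ^ (-ν i) * (q ^ (-μ i))⁻¹ := by
      rw [← zpow_neg, ← zpow_add₀ hq]; congr 1; ring
    have e2 : s ^ (2 * ((sortPerm μ i : ℕ) - (sortPerm ν i : ℕ) : ℤ)) =
        s ^ (-2 * ((sortPerm ν i : ℕ) : ℤ) + m) * (s ^ (-2 * ((sortPerm μ i : ℕ) : ℤ) + m))⁻¹ := by
      rw [← zpow_neg, ← zpow_add₀ hs]; congr 1; ring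
    rw [e1, e2, mul_mul_mul_comm, ← mul_inv, h1]
    exact mul_inv_cancel₀ (mul_ne_zero (zpow_ne_zero _ hq) (zpow_ne_zero _ hs))
  -- More indices precede `i` in the order of `ν` than in that of `μ`. For a `j` in the difference,
  -- `ν j ≤ ν i < μ i ≤ μ j`, so `j` is an earlier index where `μ` exceeds `ν`.
  obtain ⟨j, hj, hj'⟩ : ∃ j, sortPerm ν j < sortPerm ν i ∧ ¬ sortPerm μ j < sortPerm μ i := by
    by_contra hall
    push Not at hall
    have h1 : (Finset.univ.filter fun j => sortPerm ν j < sortPerm ν i) ⊆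
        Finset.univ.filter fun j => sortPerm μ j < sortPerm μ i := fun j hj => by
      simpa using hall j (by simpa using hj)
    have h2 := Finset.card_le_card h1
    rw [card_filter_perm_lt, card_filter_perm_lt] at h2
    omega
  refine (hmin j ?_).not_gt hj
  rw [sortPerm_lt_iff] at hj hj'
  omega

theorem eigenvalue_injective {m : ℕ} {q s : ℂ} (hq : q ≠ 0) (hs : s ≠ 0)
    (hgen : ∀ a b : ℕ, 1 ≤ a → b ≤ m → q ^ a * (s ^ 2) ^ b ≠ 1) {μ ν : Fin (m + 1) → ℤ}
    (h : ∀ i, q ^ (-μ i) * s ^ eigExp μ i = q ^ (-ν i) * s ^ eigExp ν i) : μ = ν :=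
  le_antisymm (eigenvalue_le hq hs hgen h) (eigenvalue_le hq hs hgen fun i => (h i).symm)

/-- The difference is a joint eigenvector with the eigenvalues of `μ`. If it were nonzero, `μ` would
be one of its exponents, but the two coefficients `1` cancel there. -/
theorem IsE.unique {m : ℕ} {q s : ℂ} (hq : q ≠ 0) (hs : s ≠ 0)
    (hgen : ∀ a b : ℕ, 1 ≤ a → b ≤ m → q ^ a * (s ^ 2) ^ b ≠ 1) {μ : Fin (m + 1) → ℤ}
    {f h : Laurent (m + 1)} (hf : IsE q s μ f) (hh : IsE q s μ h) : f = h := by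
  by_contra hne
  obtain ⟨ν, hν, hc⟩ := exists_eigenvalue (f := f - h) hq hs (sub_ne_zero.mpr hne)
    (c := fun i => q ^ (-μ i) * s ^ eigExp μ i) fun i => by
      rw [map_sub, hf.1, hh.1, eigExp_eq, smul_sub]
  obtain rfl := eigenvalue_injective hq hs hgen hc
  exact hν (by rw [AddMonoidAlgebra.coeff_sub, Finsupp.sub_apply, hf.2, hh.2, sub_self])

theorem IsE.E_eq {m : ℕ} {q s : ℂ} (hq : q ≠ 0) (hs : s ≠ 0)
    (hgen : ∀ a b : ℕ, 1 ≤ a → b ≤ m → q ^ a * (s ^ 2) ^ b ≠ 1) {μ : Fin (m + 1) → ℤ}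
    {f : Laurent (m + 1)} (hf : IsE q s μ f) : E q s μ = f :=
  IsE.unique hq hs hgen (Classical.epsilon_spec ⟨f, hf⟩) hf

/-! ### Families that are permuted by the `T_i` and by `g` -/

/-- A family of Laurent polynomials, indexed by the rearrangements of `lam`, which is permuted by
the `T_i` and by `g` up to scalars. It is given as a function of the permutation `w` that takes
`lam` to the rearrangement. -/
structure IsKZFamily {m : ℕ} (q s : ℂ) (lam : Fin (m + 1) → ℤ)
    (F : Equiv.Perm (Fin (m + 1)) → Laurent (m + 1)) : Prop where
  congr : ∀ w u, permVec w lam = permVec u lam → F w = F u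
  step : ∀ w (i : Fin m), permVec w lam i.succ < permVec w lam i.castSucc →
    s • T s i (F w) = F (simple i * w)
  fix : ∀ w (i : Fin m), permVec w lam i.castSucc = permVec w lam i.succ →
    T s i (F w) = s • F w
  rotate : ∀ w, g q (F w) = q ^ (-permVec w lam (Fin.last m)) • F (rotation m * w)

section KZ

variable {m : ℕ} {q s : ℂ} {lam : Fin (m + 1) → ℤ}
  {F : Equiv.Perm (Fin (m + 1)) → Laurent (m + 1)}

theorem permVec_simple_of_eq {i : Fin m} {ν : Fin (m + 1) → ℤ} (h : ν i.castSucc = ν i.succ) :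
    permVec (simple i) ν = ν := by
  rw [permVec_simple, h]; simp

theorem Tinv_apply_of_T {i : Fin m} (hs : s ≠ 0) {f h : Laurent (m + 1)} (e : T s i f = h) :
    Tinv s i h = f := by
  rw [← e]
  exact LinearMap.congr_fun (Tinv_mul_T hs i) f

/-- This is `rel_Y` for membership in the family, with `π` and `ν` ordered oppositely. Then every
`T_i` on the path meets a weak descent of `ν` and every `T_i⁻¹` a weak ascent, which is what `step`
and `fix` cover. -/
theorem IsKZFamily.Y_apply (hF : IsKZFamily q s lam F) (hq : q ≠ 0) (hs : s ≠ 0)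
    (hlam : Antitone lam) (i : Fin (m + 1)) :
    Y q s i (F 1) = (q ^ (-lam i) * s ^ eigExp lam i) • F 1 := by
  let Rel (π ν : Fin (m + 1) → ℤ) (f : Laurent (m + 1)) : Prop :=
    ∃ w, ν = permVec w lam ∧ f = F w ∧ ∀ i j, π i < π j → ν j ≤ ν i
  have hfix (w : Equiv.Perm (Fin (m + 1))) (i : Fin m)
      (h : permVec w lam i.castSucc = permVec w lam i.succ) : F (simple i * w) = F w :=
    hF.congr _ _ (by rw [permVec_mul, permVec_simple_of_eq h])
  have key := rel_Y (q := q) (Rel := Rel) hs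
    (by
      rintro π ν f i hπ ⟨w, rfl, rfl, h⟩
      refine ⟨simple i * w, (permVec_mul _ _ _).symm, ?_, fun a b hab => h _ _ hab⟩
      rcases (h _ _ hπ).lt_or_eq with hlt | heq
      · rw [swapSign, if_neg hlt.not_ge, neg_neg, zpow_one, hF.step w i hlt]
      · rw [swapSign, if_pos heq.ge, zpow_neg_one, hF.fix w i heq.symm, hfix w i heq.symm,
          smul_smul, inv_mul_cancel₀ hs, one_smul])
    (by
      rintro π ν f i hπ ⟨w, rfl, rfl, h⟩
      refine ⟨simple i * w, (permVec_mul _ _ _).symm, ?_, fun a b hab => h _ _ hab⟩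
      rcases (h _ _ hπ).lt_or_eq with hlt | heq
      · have h1 := hF.step (simple i * w) i (by
          rw [permVec_mul, permVec_simple_apply, permVec_simple_apply, simple_castSucc,
            simple_succ]
          exact hlt)
        rw [← mul_assoc, simple_mul_simple, one_mul, ← map_smul] at h1
        rw [swapSign, if_neg hlt.not_ge, zpow_neg_one, Tinv_apply_of_T hs h1, smul_smul,
          inv_mul_cancel₀ hs, one_smul]
      · have h1 : T s i (s⁻¹ • F w) = F w := by
          rw [map_smul, hF.fix w i heq, smul_smul, inv_mul_cancel₀ hs, one_smul]
        rw [swapSign, if_pos heq.ge, zpow_one, Tinv_apply_of_T hs h1, hfix w i heq, smul_smul,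
          mul_inv_cancel₀ hs, one_smul])
    (by
      rintro π ν f ⟨w, rfl, rfl, h⟩
      refine ⟨rotation m * w, (permVec_mul _ _ _).symm, ?_, fun a b hab => h _ _ hab⟩
      rw [hF.rotate, smul_smul, ← zpow_add₀ hq, add_neg_cancel, zpow_zero, one_smul])
    (π := fun i => ((i : ℕ) : ℤ)) (ν := lam) (f := F 1) (fun a b hab => by simpa using hab)
    ⟨1, (permVec_one _).symm, rfl, fun a b hab => hlam (by
      have : (a : ℕ) < b := by simpa using hab
      exact le_of_lt this)⟩ i
  obtain ⟨w, h1, h2, -⟩ := key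
  -- The path may end at a nontrivial element of the stabilizer of `lam`; the family does not see
  -- it.
  have h3 : F w = F 1 := hF.congr _ _ (by rw [← h1, permVec_one])
  rw [h3] at h2
  conv_rhs => rw [← h2]
  rw [smul_smul]
  have e : q ^ (-lam i) * s ^ eigExp lam i * (q ^ lam i * s ^ (-eigExp lam i)) = 1 := by
    rw [zpow_neg, zpow_neg]
    have := zpow_ne_zero (lam i) hq
    have := zpow_ne_zero (eigExp lam i) hs
    field_simp
  rw [e, one_smul]

theorem IsKZFamily.isE (hF : IsKZFamily q s lam F) (hq : q ≠ 0) (hs : s ≠ 0)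
    (hlam : Antitone lam) (h1 : (F 1).coeff lam = 1) : IsE q s lam (F 1) :=
  ⟨fun i => by rw [hF.Y_apply hq hs hlam, eigExp_eq], h1⟩

end KZ

/-! ### Reduced words -/

/-- The number of ascending pairs of entries. -/
def ascents {n : ℕ} (ν : Fin n → ℤ) : ℕ :=
  (Finset.univ.filter fun p : Fin n × Fin n => p.1 < p.2 ∧ ν p.1 < ν p.2).card

theorem simple_lt_simple {m : ℕ} {i : Fin m} {a b : Fin (m + 1)} (hab : a < b)
    (h : ¬ (a = i.castSucc ∧ b = i.succ)) : simple i a < simple i b := by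
  simp only [simple, Equiv.swap_apply_def]
  simp only [Fin.ext_iff, Fin.val_castSucc, Fin.val_succ] at h ⊢
  split_ifs <;> simp only [Fin.lt_def, Fin.val_castSucc, Fin.val_succ] at * <;> omega

/-- Applying `s_i` to both positions matches the ascending pairs before and after, except that the
pair `(i, i+1)` is new. -/
theorem ascents_simple {m : ℕ} {i : Fin m} {ν : Fin (m + 1) → ℤ}
    (h : ν i.succ < ν i.castSucc) : ascents (permVec (simple i) ν) = ascents ν + 1 := by
  have hlt : i.castSucc < i.succ := Fin.castSucc_lt_succ
  have hss (a) : simple i (simple i a) = a := Equiv.swap_apply_self _ _ _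
  have hmem : (i.castSucc, i.succ) ∈ Finset.univ.filter fun p : Fin (m + 1) × Fin (m + 1) =>
      p.1 < p.2 ∧ permVec (simple i) ν p.1 < permVec (simple i) ν p.2 := by
    simpa [hlt, permVec_simple_apply, simple_castSucc, simple_succ] using h
  rw [ascents, ← Finset.card_erase_add_one hmem, ascents]
  congr 1
  refine Finset.card_bij' (fun p _ => (simple i p.1, simple i p.2))
    (fun p _ => (simple i p.1, simple i p.2)) ?_ ?_ (by simp [hss]) (by simp [hss])
  · rintro ⟨a, b⟩ hp
    simp only [Finset.mem_erase, Finset.mem_filter, Finset.mem_univ, true_and, ne_eq,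
      Prod.mk.injEq, permVec_simple_apply] at hp ⊢
    exact ⟨simple_lt_simple hp.2.1 hp.1, hp.2.2⟩
  · rintro ⟨a, b⟩ hp
    simp only [Finset.mem_erase, Finset.mem_filter, Finset.mem_univ, true_and, ne_eq,
      Prod.mk.injEq, permVec_simple_apply, hss] at hp ⊢
    have hne : ¬ (a = i.castSucc ∧ b = i.succ) := by
      rintro ⟨rfl, rfl⟩
      exact hp.2.not_gt h
    refine ⟨?_, simple_lt_simple hp.1 hne, hp.2⟩
    rintro ⟨ha, hb⟩
    have ha' : a = i.succ := by rw [← hss a, ha, simple_castSucc]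
    have hb' : b = i.castSucc := by rw [← hss b, hb, simple_succ]
    rw [ha', hb'] at hp
    exact hp.1.not_gt hlt

theorem ascents_simple_of_lt {m : ℕ} {i : Fin m} {ν : Fin (m + 1) → ℤ}
    (h : ν i.castSucc < ν i.succ) : ascents (permVec (simple i) ν) + 1 = ascents ν := by
  rw [← ascents_simple (ν := permVec (simple i) ν) (i := i)
    (by simpa [permVec_simple_apply, simple_castSucc, simple_succ] using h),
    permVec_simple_simple]

theorem ascents_simple_le {m : ℕ} (i : Fin m) (ν : Fin (m + 1) → ℤ) :
    ascents (permVec (simple i) ν) ≤ ascents ν + 1 := by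
  rcases lt_trichotomy (ν i.castSucc) (ν i.succ) with h | h | h
  · have := ascents_simple_of_lt h
    omega
  · rw [permVec_simple_of_eq h]
    omega
  · rw [ascents_simple h]

theorem ascents_of_antitone {n : ℕ} {lam : Fin n → ℤ} (h : Antitone lam) : ascents lam = 0 := by
  rw [ascents, Finset.card_eq_zero, Finset.filter_eq_empty_iff]
  rintro p - ⟨h1, h2⟩
  exact (h h1.le).not_gt h2

theorem ascents_prod_le {m : ℕ} {lam : Fin (m + 1) → ℤ} (h : Antitone lam) (l : List (Fin m)) :
    ascents (permVec (l.map simple).prod lam) ≤ l.length := by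
  induction l with
  | nil => simp [permVec_one, ascents_of_antitone h]
  | cons i l ih =>
    rw [List.map_cons, List.prod_cons, permVec_mul, List.length_cons]
    exact (ascents_simple_le _ _).trans (by omega)

/-- Bubble sort: an adjacent swap at an ascent lowers the number of ascents by one, and a vector
without ascents is weakly decreasing. -/
theorem exists_word {m : ℕ} {lam : Fin (m + 1) → ℤ} (h : Antitone lam)
    (w : Equiv.Perm (Fin (m + 1))) : ∃ l : List (Fin m),
      permVec (l.map simple).prod lam = permVec w lam ∧ l.length = ascents (permVec w lam) := by
  induction hk : ascents (permVec w lam) generalizing w with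
  | zero =>
    have hw : Antitone (permVec w lam) := fun a b hab => by
      by_contra hlt
      rw [ascents, Finset.card_eq_zero, Finset.filter_eq_empty_iff] at hk
      refine hk (Finset.mem_univ (a, b))
        ⟨lt_of_le_of_ne hab fun e => hlt ?_, not_le.mp hlt⟩
      rw [show a = b from e]
    refine ⟨[], ?_, rfl⟩
    rw [List.map_nil, List.prod_nil, permVec_one]
    -- Only one rearrangement of `lam` is weakly decreasing.
    exact Tuple.unique_antitone (f := lam) (σ := 1) (τ := w⁻¹) h hw
  | succ k ih =>
    have hw : ¬ Antitone (permVec w lam) := fun ha => by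
      rw [ascents_of_antitone ha] at hk
      omega
    rw [Fin.antitone_iff_succ_le] at hw
    push Not at hw
    obtain ⟨i, hi⟩ := hw
    have h1 := ascents_simple_of_lt hi
    rw [← permVec_mul] at h1
    obtain ⟨l, hl, hl'⟩ := ih (simple i * w) (by omega)
    refine ⟨i :: l, ?_, by simp [hl']⟩
    rw [List.map_cons, List.prod_cons, permVec_mul, hl, permVec_mul, permVec_simple_simple]

/-- Ascents of the rearranged decreasing vector are inversions of `w⁻¹`, in bijection with those of
`w`. Statements on words acting on vectors thereby yield statements on reduced words. -/
theorem length_eq_ascents {n : ℕ} (w : Equiv.Perm (Fin n)) :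
    length w = ascents (permVec w fun i => -((i : ℕ) : ℤ)) := by
  rw [length, ascents]
  refine Finset.card_bij' (fun p _ => (w p.2, w p.1)) (fun p _ => (w⁻¹ p.2, w⁻¹ p.1))
    ?_ ?_ (by simp) (by simp)
  · rintro ⟨a, b⟩ hp
    simpa [permVec_apply, and_comm] using hp
  · rintro ⟨a, b⟩ hp
    simpa [permVec_apply, and_comm] using hp

theorem antitone_neg_val (n : ℕ) : Antitone fun i : Fin n => -((i : ℕ) : ℤ) := fun a b hab => by
  simpa using hab

theorem exists_isReducedWord {m : ℕ} (w : Equiv.Perm (Fin (m + 1))) :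
    ∃ l, IsReducedWord w l := by
  obtain ⟨l, h1, h2⟩ := exists_word (antitone_neg_val (m + 1)) w
  -- The entries of `(0, -1, -2, …)` are distinct, so the rearranged vector determines the
  -- permutation.
  refine ⟨l, inv_injective (Equiv.ext fun i => ?_), by rw [h2, length_eq_ascents]⟩
  have h3 := congrFun h1 i
  rw [permVec_apply, permVec_apply] at h3
  exact Fin.ext (by simpa using h3)

theorem length_prod_le {m : ℕ} (l : List (Fin m)) : length (l.map simple).prod ≤ l.length := by
  rw [length_eq_ascents]
  exact ascents_prod_le (antitone_neg_val _) l

theorem transport_spec {n : ℕ} {lam ν : Fin n → ℤ} (hν : ν ∈ orbit lam) :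
    IsMinLength {w | permVec w lam = ν} (transport lam ν) := by
  obtain ⟨w, -, hw⟩ := Finset.mem_image.mp hν
  exact Classical.epsilon_spec (exists_isMinLength ⟨w, hw⟩)

section KZ

variable {m : ℕ} {q s : ℂ} {lam : Fin (m + 1) → ℤ}
  {F : Equiv.Perm (Fin (m + 1)) → Laurent (m + 1)}

/-- A letter adds at most one ascent. If the total equals the length of the word, every letter adds
exactly one, so it acts at a strict descent, where `step` applies. -/
theorem IsKZFamily.prod_T (hF : IsKZFamily q s lam F) (hlam : Antitone lam) (l : List (Fin m))
    (hl : ascents (permVec (l.map simple).prod lam) = l.length) :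
    s ^ l.length • (l.map (T s)).prod (F 1) = F (l.map simple).prod := by
  induction l with
  | nil => simp
  | cons i l ih =>
    rw [List.map_cons, List.prod_cons, permVec_mul, List.length_cons] at hl
    have h1 := ascents_prod_le hlam l
    have h2 := ascents_simple_le i (permVec (l.map simple).prod lam)
    have h3 : permVec (l.map simple).prod lam i.succ <
        permVec (l.map simple).prod lam i.castSucc := by
      by_contra h
      rcases (not_lt.mp h).lt_or_eq with h | h
      · have := ascents_simple_of_lt h
        omega
      · rw [permVec_simple_of_eq h] at hl
        omega
    rw [List.map_cons, List.prod_cons, List.map_cons, List.prod_cons, List.length_cons,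
      ← hF.step _ i h3, ← ih (by omega), map_smul, smul_smul, Module.End.mul_apply, pow_succ']

/-- A reduced word of the minimal `z` with `z lam = ν` has exactly as many letters as `ν` has
ascents: at least that many since a letter adds at most one, and no more because bubble sort
provides a competitor. Hence `prod_T` applies to any reduced word, and the choice in `TPerm` is
immaterial. -/
theorem IsKZFamily.P_eq (hF : IsKZFamily q s lam F) (hlam : Antitone lam)
    (hE : E q s lam = F 1) : P q s lam = ∑ ν ∈ orbit lam, F (transport lam ν) := by
  refine Finset.sum_congr rfl fun ν hν => ?_
  have hz := transport_spec hν
  have hz1 : permVec (transport lam ν) lam = ν := hz.1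
  obtain ⟨h1, h2⟩ : IsReducedWord (transport lam ν)
      (Classical.epsilon (IsReducedWord (transport lam ν))) :=
    Classical.epsilon_spec (exists_isReducedWord _)
  obtain ⟨l, h3, h4⟩ := exists_word hlam (transport lam ν)
  have h5 := (hz.2 (l.map simple).prod (h3.trans hz1)).trans (length_prod_le l)
  rw [hE, TPerm, ← h2]
  set l' := Classical.epsilon (IsReducedWord (transport lam ν))
  have h6 := ascents_prod_le hlam l'
  rw [h1] at h6
  have h7 := hF.prod_T hlam l' (by rw [h1]; omega)
  rw [h7, h1]

end KZ

/-! ### Calculus of the operators `T_i` and `g` -/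

/-- Multiplying by the nonzero factor `x_i - x_{i+1}` clears the denominator of `T_i` and turns its
evaluation into a polynomial identity. -/
theorem smul_T_eq {m : ℕ} {s : ℂ} (hs : s ≠ 0) {i : Fin m} {f h : Laurent (m + 1)}
    (e : (x i.castSucc - x i.succ) * h = (1 - algebraMap ℂ _ (s ^ 2)) * x i.succ * f +
      (algebraMap ℂ _ (s ^ 2) * x i.castSucc - x i.succ) * perm (simple i) f) :
    s • T s i f = h := by
  refine mul_left_cancel₀ (x_sub_x_ne_zero i) (Eq.trans ?_ e.symm)
  have h1 : s • T s i f = s ^ 2 • f - (s ^ 2 • x i.castSucc - x i.succ) * divDiff i f := by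
    simp [T, smul_smul, hs]
  rw [h1, Algebra.smul_def, Algebra.smul_def]
  linear_combination (-(algebraMap ℂ _ (s ^ 2) * x i.castSucc - x i.succ)) * divDiff_spec i f

theorem T_of_perm_eq {m : ℕ} {s : ℂ} (hs : s ≠ 0) {i : Fin m} {f : Laurent (m + 1)}
    (h : perm (simple i) f = f) : T s i f = s • f := by
  have h1 : s • T s i f = s ^ 2 • f := smul_T_eq hs (by rw [h, Algebra.smul_def]; ring)
  rw [pow_two, mul_smul] at h1
  exact smul_right_injective _ hs h1

/-- Both the rescaling of the last variable and the permutation of variables are multiplicative, so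
`g` is determined by its values on the variables. -/
theorem g_mul {m : ℕ} {q : ℂ} (hq : q ≠ 0) (f h : Laurent (m + 1)) :
    g q (f * h) = g q f * g q h := by
  have h1 (μ : Fin (m + 1) → ℤ) (h : Laurent (m + 1)) :
      g q (mono μ * h) = g q (mono μ) * g q h := by
    refine LinearMap.congr_fun (f := g q ∘ₗ LinearMap.mulLeft ℂ (mono μ))
      (g := LinearMap.mulLeft ℂ (g q (mono μ)) ∘ₗ g q) (linearMap_ext fun ν => ?_) h
    simp only [LinearMap.comp_apply, LinearMap.mulLeft_apply, mono_mul, g_mono, map_add,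
      Pi.add_apply, smul_mul_smul_comm, neg_add, zpow_add₀ hq]
  refine LinearMap.congr_fun (f := g q ∘ₗ LinearMap.mulRight ℂ h)
    (g := LinearMap.mulRight ℂ (g q h) ∘ₗ g q) (linearMap_ext fun ν => ?_) f
  exact h1 ν h

/-- The factor that `g` puts in front of the image of the variable `x_k`. -/
def shiftFactor {m : ℕ} (q : ℂ) (k : Fin (m + 1)) : ℂ := if k = Fin.last m then q⁻¹ else 1

theorem g_x {m : ℕ} (q : ℂ) (k : Fin (m + 1)) :
    g q (x k) = shiftFactor q k • x (rotation m k) := by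
  rw [x, g_mono, permVec_eps, x, shiftFactor]
  congr 1
  split_ifs with h
  · subst h
    simp [eps]
  · rw [eps, Pi.single_eq_of_ne (Ne.symm h)]
    simp

/-- The part of a linear combination of the `x_k ^ r` which does not involve `x_i`, `x_{i+1}`. -/
def offSum {m : ℕ} (i : Fin m) (u : Fin (m + 1) → ℂ) (r : ℕ) : Laurent (m + 1) :=
  ∑ k with k ≠ i.castSucc ∧ k ≠ i.succ, u k • x k ^ r

theorem sum_eq_add_offSum {m : ℕ} (i : Fin m) (u : Fin (m + 1) → ℂ) (r : ℕ) :
    ∑ k, u k • x k ^ r =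
      u i.castSucc • x i.castSucc ^ r + u i.succ • x i.succ ^ r + offSum i u r := by
  have hne : i.castSucc ≠ i.succ := (Fin.castSucc_lt_succ (i := i)).ne
  have h : Finset.univ = insert i.castSucc (insert i.succ
      (Finset.univ.filter fun k : Fin (m + 1) => k ≠ i.castSucc ∧ k ≠ i.succ)) := by
    ext k
    simp only [Finset.mem_univ, Finset.mem_insert, Finset.mem_filter, true_and, true_iff]
    tauto
  conv_lhs => rw [h]
  rw [Finset.sum_insert (by simp [hne]), Finset.sum_insert (by simp), offSum, add_assoc]

theorem perm_offSum {m : ℕ} (i : Fin m) (u : Fin (m + 1) → ℂ) (r : ℕ) :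
    perm (simple i) (offSum i u r) = offSum i u r := by
  rw [offSum, map_sum]
  refine Finset.sum_congr rfl fun k hk => ?_
  simp only [Finset.mem_filter, Finset.mem_univ, true_and] at hk
  rw [map_smul, map_pow, perm_x, simple_of_ne hk.1 hk.2]

theorem offSum_congr {m : ℕ} {i : Fin m} {u v : Fin (m + 1) → ℂ} (r : ℕ)
    (h : ∀ k, k ≠ i.castSucc → k ≠ i.succ → u k = v k) : offSum i u r = offSum i v r :=
  Finset.sum_congr rfl fun k hk => by
    simp only [Finset.mem_filter, Finset.mem_univ, true_and] at hk
    rw [h k hk.1 hk.2]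

theorem perm_sum_of_eq {m : ℕ} {i : Fin m} {u : Fin (m + 1) → ℂ} (r : ℕ)
    (h : u i.castSucc = u i.succ) :
    perm (simple i) (∑ k, u k • x k ^ r) = ∑ k, u k • x k ^ r := by
  rw [sum_eq_add_offSum i, map_add, map_add, perm_offSum, map_smul, map_smul, map_pow, map_pow,
    perm_x, perm_x, simple_castSucc, simple_succ, h]
  abel

theorem g_sum {m : ℕ} {q : ℂ} {c : ℂ} {u v : Fin (m + 1) → ℂ}
    (h : ∀ k, u k * shiftFactor q k = c * v (rotation m k)) :
    g q (∑ k, u k • x k) = c • ∑ k, v k • x k := by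
  rw [map_sum, ← Equiv.sum_comp (rotation m) fun k => v k • x k, Finset.smul_sum]
  refine Finset.sum_congr rfl fun k _ => ?_
  rw [map_smul, g_x, smul_smul, smul_smul, h]

theorem g_sum_sq {m : ℕ} {q : ℂ} (hq : q ≠ 0) {c : ℂ} {u v : Fin (m + 1) → ℂ}
    (h : ∀ k, u k * shiftFactor q k = c * v (rotation m k)) :
    g q (∑ k, u k ^ 2 • x k ^ 2) = c ^ 2 • ∑ k, v k ^ 2 • x k ^ 2 := by
  rw [map_sum, ← Equiv.sum_comp (rotation m) fun k => v k ^ 2 • x k ^ 2, Finset.smul_sum]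
  refine Finset.sum_congr rfl fun k _ => ?_
  rw [map_smul, pow_two (x k), g_mul hq, g_x, smul_mul_smul_comm, smul_smul, smul_smul,
    ← mul_pow, ← h k, ← pow_two, ← pow_two, mul_pow]

/-! ### The family of `3 ε_1` -/

/-- The factor of `x_k` in the polynomial that belongs to the position `a`. -/
def weight {m : ℕ} (q : ℂ) (a k : Fin (m + 1)) : ℂ :=
  if k < a then q⁻¹ else if k = a then 0 else 1

/-- The polynomial of the rearrangement `3 ε_a`. -/
def cubic {m : ℕ} (q A B C : ℂ) (a : Fin (m + 1)) : Laurent (m + 1) :=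
  x a ^ 3 + A • (x a * ∑ k, weight q a k ^ 2 • x k ^ 2) +
    B • (x a ^ 2 * ∑ k, weight q a k • x k) +
    C • (x a * ((∑ k, weight q a k • x k) ^ 2 - ∑ k, weight q a k ^ 2 • x k ^ 2))

/-- The weights are designed for this: a variable wrapping around from the end to the front passes
from above `a` to below it and picks up `q⁻¹`. When `a` itself wraps around, all others pass from
below to above and the `q⁻¹` moves into the common factor. -/
theorem weight_rotation {m : ℕ} (q : ℂ) (a k : Fin (m + 1)) :
    weight q a k * shiftFactor q k = shiftFactor q a * weight q (rotation m a) (rotation m k) := by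
  induction a using Fin.lastCases with
  | last =>
    induction k using Fin.lastCases with
    | last => simp [weight]
    | cast k =>
      simp [weight, shiftFactor, rotation_last, rotation_castSucc, (Fin.castSucc_lt_last k).ne,
        Fin.castSucc_lt_last]
  | cast a =>
    induction k using Fin.lastCases with
    | last =>
      simp [weight, shiftFactor, rotation_last, rotation_castSucc, (Fin.castSucc_lt_last a).ne,
        (Fin.castSucc_lt_last a).ne', (Fin.castSucc_lt_last a).not_gt]
    | cast k =>
      simp [weight, shiftFactor, rotation_castSucc, (Fin.castSucc_lt_last k).ne,
        (Fin.castSucc_lt_last a).ne]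

theorem g_cubic {m : ℕ} {q : ℂ} (hq : q ≠ 0) (A B C : ℂ) (a : Fin (m + 1)) :
    g q (cubic q A B C a) = shiftFactor q a ^ 3 • cubic q A B C (rotation m a) := by
  have h1 := g_sum (weight_rotation q a)
  have h2 := g_sum_sq hq (weight_rotation q a)
  simp only [cubic, map_add, map_sub, map_smul, g_mul hq, pow_succ, pow_zero, one_mul] at h1 h2 ⊢
  simp only [h1, h2, g_x]
  simp only [Algebra.smul_def, map_mul]
  ring

theorem perm_cubic {m : ℕ} (q A B C : ℂ) {i : Fin m} {a : Fin (m + 1)} (h1 : a ≠ i.castSucc)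
    (h2 : a ≠ i.succ) : perm (simple i) (cubic q A B C a) = cubic q A B C a := by
  have h : weight q a i.castSucc = weight q a i.succ := by
    have e1 : i.castSucc < a ↔ i.succ < a := by
      simp only [Fin.lt_def, Fin.ext_iff, Fin.val_castSucc, Fin.val_succ, ne_eq] at *
      omega
    rw [weight, weight, if_neg h1.symm, if_neg h2.symm]
    simp only [e1]
  have e1 := perm_sum_of_eq (u := fun k => weight q a k) 1 h
  have e2 := perm_sum_of_eq (u := fun k => weight q a k ^ 2) 2 (by rw [h])
  simp only [pow_one] at e1
  simp only [cubic, map_add, map_sub, map_smul, map_mul, map_pow, e1, e2, perm_x,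
    simple_of_ne h1 h2]

/-- Moving `a` from `i` to `i + 1` changes only the weights at these two positions. The hypotheses
compare the coefficients of `x_i² x_{i+1}`, of `x_i x_{i+1}²`, and of `x_i x_{i+1}` times the linear
form in the remaining variables; all other coefficients agree automatically. -/
theorem smul_T_cubic {m : ℕ} {q s A B C : ℂ} (hs : s ≠ 0) (i : Fin m)
    (hA : A * q⁻¹ ^ 2 = (1 - s ^ 2) + A * s ^ 2)
    (hB : B * q⁻¹ = (1 - s ^ 2) + A * (s ^ 2 - 1) + B)
    (hC : 2 * (C * q⁻¹) = B * (1 - s ^ 2) + 2 * (s ^ 2 * C)) :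
    s • T s i (cubic q A B C i.castSucc) = cubic q A B C i.succ := by
  have hlt : i.castSucc < i.succ := Fin.castSucc_lt_succ
  have hw (k) (h1 : k ≠ i.castSucc) (h2 : k ≠ i.succ) :
      weight q i.succ k = weight q i.castSucc k := by
    have e1 : k < i.castSucc ↔ k < i.succ := by
      simp only [Fin.lt_def, Fin.ext_iff, Fin.val_castSucc, Fin.val_succ, ne_eq] at *
      omega
    rw [weight, weight, if_neg h1, if_neg h2]
    simp only [e1]
  have e1 := sum_eq_add_offSum i (fun k => weight q i.castSucc k) 1
  have e2 := sum_eq_add_offSum i (fun k => weight q i.castSucc k ^ 2) 2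
  have e3 := sum_eq_add_offSum i (fun k => weight q i.succ k) 1
  have e4 := sum_eq_add_offSum i (fun k => weight q i.succ k ^ 2) 2
  rw [offSum_congr 1 hw] at e3
  rw [offSum_congr 2 (v := fun k => weight q i.castSucc k ^ 2)
    fun k h1 h2 => by rw [hw k h1 h2]] at e4
  have w1 : weight q i.castSucc i.castSucc = 0 := by simp [weight]
  have w2 : weight q i.castSucc i.succ = 1 := by simp [weight, hlt.not_gt, hlt.ne']
  have w3 : weight q i.succ i.castSucc = q⁻¹ := by simp [weight, hlt]
  have w4 : weight q i.succ i.succ = 0 := by simp [weight]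
  simp only [pow_one, w1, w2, w3, w4, zero_smul, one_smul, zero_add, add_zero, one_pow,
    zero_pow two_ne_zero] at e1 e2 e3 e4
  refine smul_T_eq hs ?_
  rw [cubic, cubic, e1, e2, e3, e4]
  simp only [map_add, map_sub, map_smul, map_mul, map_pow, perm_x, perm_offSum, simple_castSucc,
    simple_succ]
  simp only [Algebra.smul_def, map_pow]
  replace hA := congrArg (algebraMap ℂ (Laurent (m + 1))) hA
  replace hB := congrArg (algebraMap ℂ (Laurent (m + 1))) hB
  replace hC := congrArg (algebraMap ℂ (Laurent (m + 1))) hC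
  simp only [map_add, map_sub, map_mul, map_pow, map_one, map_ofNat] at hA hB hC
  generalize algebraMap ℂ (Laurent (m + 1)) q⁻¹ = r at *
  generalize algebraMap ℂ (Laurent (m + 1)) A = A at *
  generalize algebraMap ℂ (Laurent (m + 1)) B = B at *
  generalize algebraMap ℂ (Laurent (m + 1)) C = C at *
  generalize algebraMap ℂ (Laurent (m + 1)) s = s at *
  generalize x i.castSucc = X at *
  generalize x i.succ = Y at *
  generalize offSum i (fun k => weight q i.castSucc k) 1 = p at *
  generalize offSum i (fun k => weight q i.castSucc k ^ 2) 2 = p' at *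
  linear_combination (X - Y) * (X ^ 2 * Y * hA + X * Y ^ 2 * hB + X * Y * p * hC)

theorem smul_eps_apply {n : ℕ} (c : ℤ) (a k : Fin n) :
    (c • eps a) k = if k = a then c else 0 := by
  simp [eps, Pi.single_apply]

/-- The scalar conditions are asked only for at least two variables: with one variable there is no
`T_i`, and the denominators in `A`, `B`, `C` may vanish. -/
theorem isKZFamily_cubic {m : ℕ} {q s A B C : ℂ} (hq : q ≠ 0) (hs : s ≠ 0) (o : Fin (m + 1))
    (hA : 1 ≤ m → A * q⁻¹ ^ 2 = (1 - s ^ 2) + A * s ^ 2)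
    (hB : 1 ≤ m → B * q⁻¹ = (1 - s ^ 2) + A * (s ^ 2 - 1) + B)
    (hC : 1 ≤ m → 2 * (C * q⁻¹) = B * (1 - s ^ 2) + 2 * (s ^ 2 * C)) :
    IsKZFamily q s ((3 : ℤ) • eps o) fun w => cubic q A B C (w o) := by
  have hv (w : Equiv.Perm (Fin (m + 1))) (k) :
      permVec w ((3 : ℤ) • eps o) k = if k = w o then 3 else 0 := by
    rw [map_zsmul, permVec_eps, smul_eps_apply]
  refine ⟨fun w u h => ?_, fun w i h => ?_, fun w i h => ?_, fun w => ?_⟩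
  · have h1 := congrFun h (w o)
    rw [hv, hv, if_pos rfl] at h1
    have h2 : w o = u o := by
      by_contra hne
      rw [if_neg hne] at h1
      omega
    rw [h2]
  · rw [hv, hv] at h
    have h1 : i.castSucc = w o := by
      by_contra hne
      rw [if_neg hne] at h
      split_ifs at h <;> omega
    rw [Equiv.Perm.mul_apply, ← h1, simple_castSucc]
    have hm : 1 ≤ m := by have := i.isLt; omega
    exact smul_T_cubic hs i (hA hm) (hB hm) (hC hm)
  · rw [hv, hv] at h
    have hne : i.castSucc ≠ i.succ := (Fin.castSucc_lt_succ (i := i)).ne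
    refine T_of_perm_eq hs (perm_cubic _ _ _ _ ?_ ?_) <;> intro h1
    · rw [h1, if_pos rfl, if_neg hne.symm] at h
      omega
    · rw [h1, if_pos rfl, if_neg hne] at h
      omega
  · rw [g_cubic hq, hv, Equiv.Perm.mul_apply, shiftFactor]
    congr 1
    simp only [@eq_comm _ (Fin.last m)]
    split_ifs
    · rw [zpow_neg, inv_pow]
      rfl
    · simp

/-! ### The family of `2 ε_1 + ε_2` -/

/-- The factor of `x_k` in the polynomial that belongs to the positions `a` and `b`. -/
def pairWeight {m : ℕ} (q t c : ℂ) (a b k : Fin (m + 1)) : ℂ :=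
  if k = a then 1 else if k = b then 0 else
  if a < b then (if k < a then c * q⁻¹ else if k < b then c * t else c)
  else (if k < b then t * (c * q⁻¹) else if k < a then c * q⁻¹ else t * c)

/-- The polynomial of the rearrangement `2 ε_a + ε_b`. -/
def pairPoly {m : ℕ} (q t c : ℂ) (a b : Fin (m + 1)) : Laurent (m + 1) :=
  x a * x b * ∑ k, pairWeight q t c a b k • x k

/-- The weight depends on the cyclic order of `a`, `b`, `k` and on which of them have wrapped
around; each case of the definition is the image of another under the rotation. -/
theorem pairWeight_rotation {m : ℕ} (q t c : ℂ) {a b : Fin (m + 1)} (hab : a ≠ b)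
    (k : Fin (m + 1)) : pairWeight q t c a b k * shiftFactor q k =
      shiftFactor q a * pairWeight q t c (rotation m a) (rotation m b) (rotation m k) := by
  have hl (i : Fin m) := Fin.castSucc_lt_last i
  induction a using Fin.lastCases with
  | last =>
    induction b using Fin.lastCases with
    | last => exact absurd rfl hab
    | cast b =>
      induction k using Fin.lastCases with
      | last => simp [pairWeight, rotation_last]
      | cast k =>
        simp only [pairWeight, shiftFactor, rotation_last, rotation_castSucc, (hl _).ne,
          (hl _).not_gt, hl, if_true, if_false, Fin.castSucc_inj, Fin.succ_inj,
          Fin.castSucc_lt_castSucc_iff, Fin.succ_lt_succ_iff, Fin.succ_ne_zero, Fin.succ_pos,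
          Fin.not_lt_zero]
        split_ifs <;> ring
  | cast a =>
    induction b using Fin.lastCases with
    | last =>
      induction k using Fin.lastCases with
      | last =>
        simp [pairWeight, shiftFactor, rotation_last, rotation_castSucc, (hl _).ne, (hl _).ne',
          (Fin.succ_ne_zero _).symm]
      | cast k =>
        simp only [pairWeight, shiftFactor, rotation_last, rotation_castSucc, (hl _).ne,
          hl, if_true, if_false, Fin.castSucc_inj, Fin.succ_inj,
          Fin.castSucc_lt_castSucc_iff, Fin.succ_lt_succ_iff, Fin.succ_ne_zero,
          Fin.not_lt_zero]
        split_ifs <;> ring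
    | cast b =>
      induction k using Fin.lastCases with
      | last =>
        simp only [pairWeight, shiftFactor, rotation_last, rotation_castSucc, (hl _).ne,
          (hl _).ne', (hl _).not_gt, if_true, if_false, Fin.castSucc_lt_castSucc_iff,
          Fin.succ_lt_succ_iff, (Fin.succ_ne_zero _).symm, Fin.succ_pos]
        split_ifs <;> ring
      | cast k =>
        simp only [pairWeight, shiftFactor, rotation_castSucc, (hl _).ne, if_false,
          Fin.castSucc_inj, Fin.succ_inj, Fin.castSucc_lt_castSucc_iff, Fin.succ_lt_succ_iff,
          one_mul, mul_one]

theorem g_pairPoly {m : ℕ} {q : ℂ} (hq : q ≠ 0) (t c : ℂ) {a b : Fin (m + 1)} (hab : a ≠ b) :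
    g q (pairPoly q t c a b) = (shiftFactor q a ^ 2 * shiftFactor q b) •
      pairPoly q t c (rotation m a) (rotation m b) := by
  simp only [pairPoly, g_mul hq, g_sum (pairWeight_rotation q t c hab), g_x]
  simp only [Algebra.smul_def, map_mul, map_pow]
  ring

theorem perm_pairPoly {m : ℕ} (q t c : ℂ) {i : Fin m} {a b : Fin (m + 1)}
    (h1 : a ≠ i.castSucc) (h2 : a ≠ i.succ) (h3 : b ≠ i.castSucc) (h4 : b ≠ i.succ) :
    perm (simple i) (pairPoly q t c a b) = pairPoly q t c a b := by
  have h : pairWeight q t c a b i.castSucc = pairWeight q t c a b i.succ := by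
    have e1 : i.castSucc < a ↔ i.succ < a := by
      simp only [Fin.lt_def, Fin.ext_iff, Fin.val_castSucc, Fin.val_succ, ne_eq] at *
      omega
    have e2 : i.castSucc < b ↔ i.succ < b := by
      simp only [Fin.lt_def, Fin.ext_iff, Fin.val_castSucc, Fin.val_succ, ne_eq] at *
      omega
    simp only [pairWeight, if_neg h1.symm, if_neg h2.symm, if_neg h3.symm, if_neg h4.symm, e1, e2]
  have e1 := perm_sum_of_eq (u := fun k => pairWeight q t c a b k) 1 h
  simp only [pow_one] at e1
  simp only [pairPoly, map_mul, e1, perm_x, simple_of_ne h1 h2, simple_of_ne h3 h4]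

/-- `s T_i` sends `x_i² x_{i+1}` to `x_i x_{i+1}²` and multiplies `x_i x_{i+1}` by `t`. Hence all
weights off the two positions gain a factor `t`, with no condition on `c`. -/
theorem smul_T_pairPoly_swap {m : ℕ} {q s c : ℂ} (hs : s ≠ 0) (i : Fin m) :
    s • T s i (pairPoly q (s ^ 2) c i.castSucc i.succ) =
      pairPoly q (s ^ 2) c i.succ i.castSucc := by
  have hlt : i.castSucc < i.succ := Fin.castSucc_lt_succ
  have hw (k) (h1 : k ≠ i.castSucc) (h2 : k ≠ i.succ) :
      pairWeight q (s ^ 2) c i.succ i.castSucc k =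
        s ^ 2 * pairWeight q (s ^ 2) c i.castSucc i.succ k := by
    have e1 : k < i.succ ↔ k < i.castSucc := by
      simp only [Fin.lt_def, Fin.ext_iff, Fin.val_castSucc, Fin.val_succ, ne_eq] at *
      omega
    simp only [pairWeight, if_neg h1, if_neg h2, e1, if_pos hlt, if_neg hlt.not_gt]
    split_ifs <;> rfl
  have e1 := sum_eq_add_offSum i (fun k => pairWeight q (s ^ 2) c i.castSucc i.succ k) 1
  have e2 := sum_eq_add_offSum i (fun k => pairWeight q (s ^ 2) c i.succ i.castSucc k) 1
  have e3 : offSum i (fun k => s ^ 2 * pairWeight q (s ^ 2) c i.castSucc i.succ k) 1 =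
      s ^ 2 • offSum i (fun k => pairWeight q (s ^ 2) c i.castSucc i.succ k) 1 := by
    simp only [offSum, Finset.smul_sum, smul_smul]
  rw [offSum_congr 1 hw, e3] at e2
  simp only [pow_one, pairWeight, if_true, if_neg hlt.ne', if_neg hlt.ne, zero_smul, one_smul,
    zero_add, add_zero] at e1 e2
  refine smul_T_eq hs ?_
  simp only [pairPoly, pairWeight, e1, e2]
  simp only [map_add, map_mul, perm_x, perm_offSum, simple_castSucc, simple_succ]
  simp only [Algebra.smul_def]
  ring

/-- The only move that restricts `c`. The square `x_i²` yields `(1 - t) x_i x_{i+1}` and the term `t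
c x_i x_{i+1}` is multiplied by `t`; together they must give the weight `c q⁻¹` of the position just
left behind. -/
theorem smul_T_pairPoly_left {m : ℕ} {q s c : ℂ} (hs : s ≠ 0) (i : Fin m)
    (hc : c * q⁻¹ = 1 - s ^ 2 + s ^ 2 * (s ^ 2 * c)) {b : Fin (m + 1)} (h1 : b ≠ i.castSucc)
    (h2 : b ≠ i.succ) :
    s • T s i (pairPoly q (s ^ 2) c i.castSucc b) = pairPoly q (s ^ 2) c i.succ b := by
  have hlt : i.castSucc < i.succ := Fin.castSucc_lt_succ
  have hb : i.castSucc < b ↔ i.succ < b := by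
    simp only [Fin.lt_def, Fin.ext_iff, Fin.val_castSucc, Fin.val_succ, ne_eq] at *
    omega
  have hw (k) (h3 : k ≠ i.castSucc) (h4 : k ≠ i.succ) :
      pairWeight q (s ^ 2) c i.succ b k = pairWeight q (s ^ 2) c i.castSucc b k := by
    have e1 : k < i.succ ↔ k < i.castSucc := by
      simp only [Fin.lt_def, Fin.ext_iff, Fin.val_castSucc, Fin.val_succ, ne_eq] at *
      omega
    simp only [pairWeight, if_neg h3, if_neg h4, e1, hb]
  have e1 := sum_eq_add_offSum i (fun k => pairWeight q (s ^ 2) c i.castSucc b k) 1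
  have e2 := sum_eq_add_offSum i (fun k => pairWeight q (s ^ 2) c i.succ b k) 1
  rw [offSum_congr 1 hw] at e2
  have w1 : pairWeight q (s ^ 2) c i.castSucc b i.castSucc = 1 := by simp [pairWeight]
  have w2 : pairWeight q (s ^ 2) c i.castSucc b i.succ = s ^ 2 * c := by
    simp only [pairWeight, if_neg hlt.ne', if_neg h2.symm, hb, if_neg hlt.not_gt]
    split_ifs <;> ring
  have w3 : pairWeight q (s ^ 2) c i.succ b i.castSucc = c * q⁻¹ := by
    simp only [pairWeight, if_neg hlt.ne, if_neg h1.symm, ← hb, if_pos hlt]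
    split_ifs <;> rfl
  have w4 : pairWeight q (s ^ 2) c i.succ b i.succ = 1 := by simp [pairWeight]
  simp only [pow_one, w1, w2, w3, w4, hc, one_smul] at e1 e2
  refine smul_T_eq hs ?_
  simp only [pairPoly, e1, e2]
  simp only [map_add, map_mul, map_smul, perm_x, perm_offSum, simple_castSucc, simple_succ,
    simple_of_ne h1 h2]
  simp only [Algebra.smul_def, map_add, map_sub, map_mul, map_one]
  ring

/-- The linear form has no term at `b`, so only the weight of the position that `b` jumps over
changes, by a factor `t`, as in the definition of `pairWeight`. -/
theorem smul_T_pairPoly_right {m : ℕ} {q s c : ℂ} (hs : s ≠ 0) (i : Fin m) {a : Fin (m + 1)}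
    (h1 : a ≠ i.castSucc) (h2 : a ≠ i.succ) :
    s • T s i (pairPoly q (s ^ 2) c a i.castSucc) = pairPoly q (s ^ 2) c a i.succ := by
  have hlt : i.castSucc < i.succ := Fin.castSucc_lt_succ
  have ha : a < i.succ ↔ a < i.castSucc := by
    simp only [Fin.lt_def, Fin.ext_iff, Fin.val_castSucc, Fin.val_succ, ne_eq] at *
    omega
  have ha' : i.castSucc < a ↔ i.succ < a := by
    simp only [Fin.lt_def, Fin.ext_iff, Fin.val_castSucc, Fin.val_succ, ne_eq] at *
    omega
  have hw (k) (h3 : k ≠ i.castSucc) (h4 : k ≠ i.succ) :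
      pairWeight q (s ^ 2) c a i.succ k = pairWeight q (s ^ 2) c a i.castSucc k := by
    have e1 : k < i.succ ↔ k < i.castSucc := by
      simp only [Fin.lt_def, Fin.ext_iff, Fin.val_castSucc, Fin.val_succ, ne_eq] at *
      omega
    simp only [pairWeight, if_neg h3, if_neg h4, e1, ha]
  have e1 := sum_eq_add_offSum i (fun k => pairWeight q (s ^ 2) c a i.castSucc k) 1
  have e2 := sum_eq_add_offSum i (fun k => pairWeight q (s ^ 2) c a i.succ k) 1
  rw [offSum_congr 1 hw] at e2
  have w1 : pairWeight q (s ^ 2) c a i.castSucc i.castSucc = 0 := by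
    simp [pairWeight, h1.symm]
  have w2 : pairWeight q (s ^ 2) c a i.succ i.castSucc =
      s ^ 2 * pairWeight q (s ^ 2) c a i.castSucc i.succ := by
    simp only [pairWeight, if_neg h1.symm, if_neg h2.symm, if_neg hlt.ne', if_neg hlt.ne,
      if_neg hlt.not_gt, if_pos hlt, ha]
    rcases lt_or_gt_of_ne h1 with h | h
    · rw [if_pos h, if_pos h, if_neg h.not_gt, if_neg fun h' => h.not_gt (ha'.mpr h')]
      ring
    · rw [if_neg h.not_gt, if_neg h.not_gt, if_pos (ha'.mp h)]
  have w3 : pairWeight q (s ^ 2) c a i.succ i.succ = 0 := by simp [pairWeight, h2.symm]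
  simp only [pow_one, w1, w2, w3, zero_smul, zero_add, add_zero] at e1 e2
  refine smul_T_eq hs ?_
  simp only [pairPoly, e1, e2]
  simp only [map_add, map_mul, map_smul, perm_x, perm_offSum, simple_castSucc, simple_succ,
    simple_of_ne h1 h2]
  simp only [Algebra.smul_def, map_mul]
  ring

theorem isKZFamily_pairPoly {m : ℕ} {q s c : ℂ} (hq : q ≠ 0) (hs : s ≠ 0) {o p : Fin (m + 1)}
    (hop : o ≠ p) (hc : 2 ≤ m → c * q⁻¹ = 1 - s ^ 2 + s ^ 2 * (s ^ 2 * c)) :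
    IsKZFamily q s ((2 : ℤ) • eps o + eps p) fun w => pairPoly q (s ^ 2) c (w o) (w p) := by
  have hv (w : Equiv.Perm (Fin (m + 1))) (k) : permVec w ((2 : ℤ) • eps o + eps p) k =
      (if k = w o then 2 else 0) + if k = w p then 1 else 0 := by
    rw [map_add, map_zsmul, permVec_eps, permVec_eps, Pi.add_apply, smul_eps_apply, eps,
      Pi.single_apply]
  have hne (w : Equiv.Perm (Fin (m + 1))) : w o ≠ w p := fun h => hop (w.injective h)
  refine ⟨fun w u h => ?_, fun w i h => ?_, fun w i h => ?_, fun w => ?_⟩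
  · have h1 : w o = u o := by
      have h1 := congrFun h (w o)
      rw [hv, hv, if_pos rfl, if_neg (hne w)] at h1
      by_contra h2
      rw [if_neg h2] at h1
      split_ifs at h1 <;> omega
    have h2 : w p = u p := by
      have h3 := congrFun h (w p)
      rw [hv, hv, if_pos rfl, if_neg (hne w).symm] at h3
      by_contra h2
      rw [if_neg h2] at h3
      split_ifs at h3 <;> omega
    rw [h1, h2]
  · rw [hv, hv] at h
    have hi : i.castSucc ≠ i.succ := (Fin.castSucc_lt_succ (i := i)).ne
    rw [Equiv.Perm.mul_apply, Equiv.Perm.mul_apply]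
    have hw := hne w
    generalize w o = a at *
    generalize w p = b at *
    by_cases h1 : i.castSucc = a
    · subst h1
      by_cases h2 : i.succ = b
      · subst h2
        rw [simple_castSucc, simple_succ]
        exact smul_T_pairPoly_swap hs i
      -- Here `i`, `i + 1` and `b` are three different positions, so the condition on `c` is
      -- available.
      · have hm : 2 ≤ m := by
          have := i.isLt
          have := b.isLt
          simp only [Fin.ext_iff, Fin.val_castSucc, Fin.val_succ, ne_eq] at *
          omega
        rw [simple_castSucc, simple_of_ne hw.symm (Ne.symm h2)]
        exact smul_T_pairPoly_left hs i (hc hm) hw.symm (Ne.symm h2)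
    · rw [if_neg h1] at h
      have h2 : i.castSucc = b := by
        by_contra h2
        rw [if_neg h2] at h
        split_ifs at h <;> omega
      subst h2
      have h3 : a ≠ i.succ := by
        rintro rfl
        simp [hi.symm] at h
      rw [simple_castSucc, simple_of_ne hw h3]
      exact smul_T_pairPoly_right hs i hw h3
  · rw [hv, hv] at h
    have hi : i.castSucc ≠ i.succ := (Fin.castSucc_lt_succ (i := i)).ne
    have hw := hne w
    refine T_of_perm_eq hs (perm_pairPoly _ _ _ ?_ ?_ ?_ ?_) <;> intro h1 <;>
      rw [h1] at h hw <;> simp only [hw, hi, hi.symm, hw.symm, if_true, if_false] at h <;>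
      split_ifs at h <;> omega
  · rw [g_pairPoly hq _ _ (hne w), hv, Equiv.Perm.mul_apply, Equiv.Perm.mul_apply, shiftFactor,
      shiftFactor, neg_add, zpow_add₀ hq]
    congr 2
    · simp only [@eq_comm _ (Fin.last m)]
      split_ifs
      · rw [zpow_neg, inv_pow]
        rfl
      · simp
    · simp only [@eq_comm _ (Fin.last m)]
      split_ifs <;> simp

/-! ### Minuscule exponent vectors -/

/-- Entries `0` and `1` differ by at most one, so root strings have no interior and `s T_i` simply
swaps the exponents at a descent. -/
theorem isKZFamily_mono {m : ℕ} {q s : ℂ} (hs : s ≠ 0) {lam : Fin (m + 1) → ℤ}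
    (hlam : ∀ k, lam k = 0 ∨ lam k = 1) :
    IsKZFamily q s lam fun w => mono (permVec w lam) := by
  refine ⟨fun w u h => by rw [h], fun w i h => ?_, fun w i h => T_mono_of_eq hs h,
    fun w => by rw [g_mono, permVec_mul]⟩
  have h1 : permVec w lam i.castSucc - permVec w lam i.succ = (0 : ℕ) + 1 := by
    have e1 : permVec w lam i.castSucc = 0 ∨ permVec w lam i.castSucc = 1 := hlam _
    have e2 : permVec w lam i.succ = 0 ∨ permVec w lam i.succ = 1 := hlam _
    omega
  rw [T_mono_of_gt s h1, permVec_mul, smul_smul, mul_inv_cancel₀ hs]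
  simp

/-! ### Orbit sums -/

theorem smul_eps_injective {n : ℕ} {c : ℤ} (hc : c ≠ 0) :
    Function.Injective fun a : Fin n => c • eps a := by
  intro a b hab
  have h1 := congrFun hab a
  simp only [smul_eps_apply, if_true] at h1
  by_contra hne
  rw [if_neg hne] at h1
  exact hc h1

theorem sum_orbit_single {n : ℕ} {M : Type*} [AddCommMonoid M] {c : ℤ} (hc : c ≠ 0) (o : Fin n)
    (G : (Fin n → ℤ) → M) : ∑ ν ∈ orbit (c • eps o), G ν = ∑ a, G (c • eps a) := by
  have h : orbit (c • eps o) = Finset.univ.image fun a : Fin n => c • eps a := by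
    ext ν
    simp only [orbit, Finset.mem_image, Finset.mem_univ, true_and, map_zsmul, permVec_eps]
    constructor
    · rintro ⟨w, h⟩
      exact ⟨w o, h⟩
    · rintro ⟨a, h⟩
      exact ⟨Equiv.swap o a, by rw [Equiv.swap_apply_left, h]⟩
  rw [h, Finset.sum_image (smul_eps_injective hc).injOn]

theorem exists_perm_pair {α : Type*} [DecidableEq α] {o p a b : α} (hop : o ≠ p) (hab : a ≠ b) :
    ∃ w : Equiv.Perm α, w o = a ∧ w p = b := by
  have h : a ≠ Equiv.swap o a p := by
    intro h
    have h1 := congrArg (Equiv.swap o a) h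
    rw [Equiv.swap_apply_right, Equiv.swap_apply_self] at h1
    exact hop h1
  exact ⟨Equiv.swap (Equiv.swap o a p) b * Equiv.swap o a, by
    rw [Equiv.Perm.mul_apply, Equiv.swap_apply_left, Equiv.swap_apply_of_ne_of_ne h hab], by
    rw [Equiv.Perm.mul_apply, Equiv.swap_apply_left]⟩

theorem pair_apply {n : ℕ} (a b k : Fin n) : ((2 : ℤ) • eps a + eps b) k =
    (if k = a then 2 else 0) + if k = b then 1 else 0 := by
  rw [Pi.add_apply, smul_eps_apply, eps, Pi.single_apply]

theorem pair_injective {n : ℕ} {a b a' b' : Fin n} (hab : a ≠ b)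
    (h : (2 : ℤ) • eps a + eps b = (2 : ℤ) • eps a' + eps b') : a = a' ∧ b = b' := by
  have h1 := congrFun h a
  have h2 := congrFun h b
  simp only [pair_apply, if_true, hab, hab.symm, if_false] at h1 h2
  split_ifs at h1 with h3 h4 <;> split_ifs at h2 with h5 h6 <;> simp_all

theorem sum_orbit_pair {n : ℕ} {M : Type*} [AddCommMonoid M] {o p : Fin n} (hop : o ≠ p)
    (G : (Fin n → ℤ) → M) : ∑ ν ∈ orbit ((2 : ℤ) • eps o + eps p), G ν =
      ∑ a, ∑ b, if a = b then 0 else G ((2 : ℤ) • eps a + eps b) := by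
  have h : orbit ((2 : ℤ) • eps o + eps p) =
      (Finset.univ.filter fun r : Fin n × Fin n => ¬ r.1 = r.2).image fun r =>
        (2 : ℤ) • eps r.1 + eps r.2 := by
    ext ν
    simp only [orbit, Finset.mem_image, Finset.mem_univ, true_and, map_add, map_zsmul,
      permVec_eps, Finset.mem_filter, Prod.exists]
    constructor
    · rintro ⟨w, h⟩
      exact ⟨w o, w p, fun e => hop (w.injective e), h⟩
    · rintro ⟨a, b, hab, h⟩
      obtain ⟨w, rfl, rfl⟩ := exists_perm_pair hop hab
      exact ⟨w, h⟩
  rw [h, Finset.sum_image, Finset.sum_filter, Fintype.sum_prod_type]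
  · simp only [ite_not]
  · rintro ⟨a, b⟩ h1 ⟨a', b'⟩ h2 he
    simp only [Finset.coe_filter, Finset.mem_univ, true_and, Set.mem_ofPred_eq] at h1
    obtain ⟨rfl, rfl⟩ := pair_injective h1 he
    rfl

/-- The exponent vector of a product of different variables. -/
def indicatorVec {n : ℕ} (S : Finset (Fin n)) : Fin n → ℤ := fun i => if i ∈ S then 1 else 0

theorem mono_indicatorVec {n : ℕ} (S : Finset (Fin n)) : mono (indicatorVec S) = ∏ i ∈ S, x i := by
  induction S using Finset.induction_on with
  | empty => rfl
  | insert a S ha ih =>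
    rw [Finset.prod_insert ha, ← ih, x, mono_mul]
    congr 1
    ext i
    by_cases h : i = a
    · subst h
      simp [indicatorVec, eps, ha]
    · simp [indicatorVec, eps, h]

theorem orbit_indicatorVec {n : ℕ} (S : Finset (Fin n)) :
    orbit (indicatorVec S) = (Finset.univ.powersetCard S.card).image indicatorVec := by
  ext ν
  simp only [orbit, Finset.mem_image, Finset.mem_univ, true_and, Finset.mem_powersetCard,
    Finset.subset_univ]
  constructor
  · rintro ⟨w, rfl⟩
    refine ⟨S.map w.toEmbedding, by simp, ?_⟩
    ext i
    simp only [indicatorVec, permVec_apply, Finset.mem_map_equiv]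
    rfl
  · rintro ⟨R, hR, rfl⟩
    -- A bijection between subsets of equal size extends to a permutation, so the orbit contains all
    -- indicator vectors of that size.
    have e : {i // i ∈ S} ≃ {i // i ∈ R} := Finset.equivOfCardEq hR.symm
    refine ⟨e.extendSubtype, ?_⟩
    ext i
    have h : (e.extendSubtype⁻¹ : Equiv.Perm (Fin n)) i ∈ S ↔ i ∈ R := by
      have h1 : e.extendSubtype ((e.extendSubtype⁻¹ : Equiv.Perm (Fin n)) i) = i := by simp
      conv_rhs => rw [← h1]
      constructor
      · exact e.extendSubtype_mem _
      · exact fun h2 => by_contra fun h3 => e.extendSubtype_not_mem _ h3 h2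
    simp only [indicatorVec, permVec_apply, h]

theorem sum_orbit_indicatorVec {n : ℕ} (S : Finset (Fin n)) :
    ∑ γ ∈ orbit (indicatorVec S), mono γ = elemSymm n S.card := by
  rw [orbit_indicatorVec, Finset.sum_image, elemSymm, MvPolynomial.esymm]
  · simp [mono_indicatorVec, map_sum, map_prod]
  · intro R _ R' _ h
    ext i
    have h1 := congrFun h i
    simp only [indicatorVec] at h1
    by_cases h2 : i ∈ R <;> by_cases h3 : i ∈ R' <;> simp_all

/-! ### Monomial symmetric functions of degree three -/

theorem getD_one_one_one (m : ℕ) :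
    (fun i : Fin (m + 3) => [1, 1, 1].getD (i : ℕ) (0 : ℤ)) =
      indicatorVec {0, 1, 2} := by
  ext i
  refine Fin.cases rfl (fun i => ?_) i
  refine Fin.cases rfl (fun i => ?_) i
  refine Fin.cases rfl (fun i => ?_) i
  have h : 2 % (m + 2 + 1) = 2 := Nat.mod_eq_of_lt (by omega)
  simp [indicatorVec, Fin.ext_iff, h]

theorem card_zero_one_two (m : ℕ) : ({0, 1, 2} : Finset (Fin (m + 3))).card = 3 := by
  have h : 2 % (m + 3) = 2 := Nat.mod_eq_of_lt (by omega)
  rw [Finset.card_eq_three]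
  exact ⟨0, 1, 2, by simp, by simp [Fin.ext_iff, h], by simp [Fin.ext_iff, h], rfl⟩

theorem monomialSymm_one_one_one (n : ℕ) : monomialSymm n [1, 1, 1] = elemSymm n 3 := by
  rw [monomialSymm]
  split_ifs with h
  · obtain ⟨m, rfl⟩ : ∃ m, n = m + 3 := ⟨n - 3, by simp at h; omega⟩
    rw [getD_one_one_one, sum_orbit_indicatorVec, card_zero_one_two]
  · rw [elemSymm, MvPolynomial.esymm, Finset.powersetCard_eq_empty.mpr, Finset.sum_empty, map_zero]
    simpa using h

theorem monomialSymm_three (m : ℕ) : monomialSymm (m + 1) [3] = ∑ a, x a ^ 3 := by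
  have h : (fun i : Fin (m + 1) => [3].getD (i : ℕ) (0 : ℤ)) = (3 : ℤ) • eps 0 := by
    ext i
    refine Fin.cases ?_ (fun i => ?_) i
    · simp [eps]
    · simp [eps]
  rw [monomialSymm, if_pos (by simp), h, sum_orbit_single (by norm_num)]
  refine Finset.sum_congr rfl fun a _ => ?_
  simp only [x, pow_succ, pow_zero, one_mul, mono_mul]
  congr 1
  module

theorem monomialSymm_two_one (m : ℕ) : monomialSymm (m + 1) [2, 1] =
    ∑ a, ∑ b, if a = b then 0 else x a ^ 2 * x b := by
  rcases m with - | m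
  · rw [monomialSymm, if_neg (by simp)]
    simp
  · have h : (fun i : Fin (m + 2) => [2, 1].getD (i : ℕ) (0 : ℤ)) = (2 : ℤ) • eps 0 + eps 1 := by
      ext i
      rw [pair_apply]
      refine Fin.cases ?_ (fun i => ?_) i
      · simp
      refine Fin.cases ?_ (fun i => ?_) i
      · simp
      · simp [Fin.ext_iff]
    rw [monomialSymm, if_pos (by simp), h, sum_orbit_pair (by simp)]
    refine Finset.sum_congr rfl fun a _ => Finset.sum_congr rfl fun b _ => ?_
    simp only [x, pow_succ, pow_zero, one_mul, mono_mul]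
    congr 2
    module

/-- The product of three different variables, or zero. -/
def triple {n : ℕ} (a b c : Fin n) : Laurent n :=
  if a = b ∨ a = c ∨ b = c then 0 else x a * x b * x c

theorem triple_swap_left {n : ℕ} (a b c : Fin n) : triple b a c = triple a b c := by
  rw [triple, triple]
  congr 1
  · rw [eq_comm (a := b)]
    exact propext ⟨by tauto, by tauto⟩
  · ring

theorem triple_swap_right {n : ℕ} (a b c : Fin n) : triple a c b = triple a b c := by
  rw [triple, triple]
  congr 1
  · rw [eq_comm (a := c)]
    exact propext ⟨by tauto, by tauto⟩
  · ring

/-- Inclusion–exclusion over coinciding indices gives `p₁³ - 3 p₂ p₁ + 2 p₃` in power sums, which is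
`6 e₃` by Newton's identities. This route needs no case distinction for fewer than three variables.
-/
theorem sum_triple (n : ℕ) :
    ∑ a : Fin n, ∑ b, ∑ c, triple a b c = (6 : ℂ) • monomialSymm n [1, 1, 1] := by
  have h1 : ∑ a : Fin n, ∑ b, ∑ c, triple a b c = (∑ a : Fin n, x a) ^ 3 -
      3 * ((∑ a : Fin n, x a ^ 2) * ∑ a : Fin n, x a) + 2 * ∑ a : Fin n, x a ^ 3 := by
    have e (a b c : Fin n) : triple a b c = x a * x b * x c -
        (if a = b then x b ^ 2 * x c else 0) - (if a = c then x c ^ 2 * x b else 0) -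
        (if b = c then x a * x c ^ 2 else 0) +
        2 * if a = b then if b = c then x c ^ 3 else 0 else 0 := by
      rw [triple]
      by_cases h1 : a = b
      · subst h1
        by_cases h2 : a = c
        · subst h2
          simp only [or_self, if_true]
          ring
        · simp [h2]
          ring
      · by_cases h2 : a = c
        · subst h2
          simp [h1, Ne.symm h1]
          ring
        · by_cases h3 : b = c
          · subst h3
            simp [h1]
            ring
          · simp [h1, h2, h3]
    simp only [e, Finset.sum_add_distrib, Finset.sum_sub_distrib, Finset.sum_ite_eq,
      Finset.sum_ite_irrel, Finset.sum_const_zero, Finset.mem_univ, if_true, ← Finset.mul_sum,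
      ← Finset.sum_mul]
    ring
  rw [h1, monomialSymm_one_one_one, elemSymm]
  have n3 := congrArg (MvPolynomial.aeval (x : Fin n → Laurent n))
    (MvPolynomial.mul_esymm_eq_sum (Fin n) ℂ 3)
  have n2 := congrArg (MvPolynomial.aeval (x : Fin n → Laurent n))
    (MvPolynomial.mul_esymm_eq_sum (Fin n) ℂ 2)
  have a3 : (Finset.HasAntidiagonal.antidiagonal 3).filter (fun a : ℕ × ℕ => a.1 < 3) =
      {(0, 3), (1, 2), (2, 1)} := rfl
  have a2 : (Finset.HasAntidiagonal.antidiagonal 2).filter (fun a : ℕ × ℕ => a.1 < 2) =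
      {(0, 2), (1, 1)} := rfl
  rw [a3, Finset.sum_insert (by simp), Finset.sum_insert (by simp), Finset.sum_singleton] at n3
  rw [a2, Finset.sum_insert (by simp), Finset.sum_singleton] at n2
  simp only [MvPolynomial.esymm_zero, MvPolynomial.esymm_one, MvPolynomial.psum, map_mul, map_add,
    map_sum, map_pow, map_neg, map_one, map_natCast, MvPolynomial.aeval_X] at n2 n3
  rw [Algebra.smul_def, map_ofNat]
  push_cast at n2 n3
  simp only [pow_one] at n2 n3
  linear_combination (-2) * n3 + (-(∑ a : Fin n, x a)) * n2

/-- A weighted sum over triples depends only on the symmetrization of the weight. -/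
theorem sum_smul_triple {n : ℕ} {W : Fin n → Fin n → Fin n → ℂ} {κ : ℂ}
    (h : ∀ a b c, a < b → b < c →
      W a b c + W a c b + W b a c + W b c a + W c a b + W c b a = 6 * κ) :
    ∑ a, ∑ b, ∑ c, W a b c • triple a b c = (6 * κ) • monomialSymm n [1, 1, 1] := by
  have hs (a b c : Fin n) (hab : a ≠ b) (hac : a ≠ c) (hbc : b ≠ c) :
      W a b c + W a c b + W b a c + W b c a + W c a b + W c b a = 6 * κ := by
    rcases lt_or_gt_of_ne hab with h1 | h1 <;> rcases lt_or_gt_of_ne hac with h2 | h2 <;>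
      rcases lt_or_gt_of_ne hbc with h3 | h3
    · linear_combination h a b c h1 h3
    · linear_combination h a c b h2 h3
    · omega
    · linear_combination h c a b h2 h1
    · linear_combination h b a c h1 h2
    · omega
    · linear_combination h b c a h3 h2
    · linear_combination h c b a h3 h1
  -- Since `triple` is symmetric, renaming the summation indices shows that all six rearrangements
  -- of the weight give the same sum.
  have e1 : ∑ a, ∑ b, ∑ c, W a c b • triple a b c = ∑ a, ∑ b, ∑ c, W a b c • triple a b c := by
    refine Finset.sum_congr rfl fun a _ => ?_
    rw [Finset.sum_comm]
    simp only [triple_swap_right]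
  have e2 : ∑ a, ∑ b, ∑ c, W b a c • triple a b c = ∑ a, ∑ b, ∑ c, W a b c • triple a b c := by
    rw [Finset.sum_comm]
    simp only [triple_swap_left]
  have e3 : ∑ a, ∑ b, ∑ c, W b c a • triple a b c = ∑ a, ∑ b, ∑ c, W a b c • triple a b c := by
    rw [← e1, Finset.sum_comm]
    simp only [triple_swap_left]
  have e4 : ∑ a, ∑ b, ∑ c, W c a b • triple a b c = ∑ a, ∑ b, ∑ c, W a b c • triple a b c := by
    rw [← e2]
    refine Finset.sum_congr rfl fun a _ => ?_
    rw [Finset.sum_comm]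
    simp only [triple_swap_right]
  have e5 : ∑ a, ∑ b, ∑ c, W c b a • triple a b c = ∑ a, ∑ b, ∑ c, W a b c • triple a b c := by
    rw [← e3]
    refine Finset.sum_congr rfl fun a _ => ?_
    rw [Finset.sum_comm]
    simp only [triple_swap_right]
  have e6 : (6 : ℂ) • ∑ a, ∑ b, ∑ c, W a b c • triple a b c =
      (6 * κ) • ∑ a : Fin n, ∑ b, ∑ c, triple a b c := by
    have e7 : ∑ a, ∑ b, ∑ c, (W a b c + W a c b + W b a c + W b c a + W c a b + W c b a) •
        triple a b c = (6 : ℂ) • ∑ a, ∑ b, ∑ c, W a b c • triple a b c := by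
      simp only [add_smul, Finset.sum_add_distrib, e1, e2, e3, e4, e5]
      module
    rw [← e7]
    simp only [Finset.smul_sum]
    refine Finset.sum_congr rfl fun a _ => Finset.sum_congr rfl fun b _ =>
      Finset.sum_congr rfl fun c _ => ?_
    by_cases h : a = b ∨ a = c ∨ b = c
    · rw [triple, if_pos h, smul_zero, smul_zero]
    · push Not at h
      rw [hs a b c h.1 h.2.1 h.2.2]
  rw [sum_triple, smul_comm] at e6
  exact smul_right_injective _ (by norm_num) e6

/-! ### Sums of the families -/

theorem cubic_eq_sum {m : ℕ} (q A B C : ℂ) (a : Fin (m + 1)) :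
    cubic q A B C a = x a ^ 3 + ∑ k, (A * weight q a k ^ 2) • (x a * x k ^ 2) +
      ∑ k, (B * weight q a k) • (x a ^ 2 * x k) +
      C • ∑ k, ∑ l, (weight q a k * weight q a l) • triple a k l := by
  have h (k l : Fin (m + 1)) : (weight q a k * weight q a l) • triple a k l =
      x a * ((weight q a k • x k) * (weight q a l • x l)) -
        if k = l then x a * (weight q a l ^ 2 • x l ^ 2) else 0 := by
    -- The vanishing weight at `a` removes the terms with `k = a` or `l = a`, where `triple` is zero
    -- but the product of variables is not.
    have w : weight q a a = 0 := by simp [weight]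
    by_cases h1 : k = l
    · subst h1
      simp only [triple, or_true, if_true, Algebra.smul_def, map_pow]
      ring
    · rw [if_neg h1, sub_zero]
      by_cases h2 : a = k
      · subst h2
        simp [w]
      by_cases h3 : a = l
      · subst h3
        simp [w]
      rw [triple, if_neg (by tauto)]
      simp only [Algebra.smul_def, map_mul]
      ring
  have h4 : ∑ k, ∑ l, (weight q a k * weight q a l) • triple a k l =
      x a * ((∑ k, weight q a k • x k) ^ 2 - ∑ k, weight q a k ^ 2 • x k ^ 2) := by
    simp only [h, Finset.sum_sub_distrib, Finset.sum_ite_eq, Finset.mem_univ, if_true,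
      ← Finset.mul_sum, ← Finset.sum_mul]
    ring
  rw [h4, cubic]
  simp only [Finset.mul_sum, Finset.smul_sum, mul_smul, mul_smul_comm]

/-- The monomial `x_a² x_k` comes from the `B`-part of position `a` and from the `A`-part of
position `k`. The two hypotheses say that its coefficient is the same for `a < k` and for `k < a`.
-/
theorem sum_cubic {m : ℕ} {q A B C α : ℂ} (h1 : 1 ≤ m → A * q⁻¹ ^ 2 + B = α)
    (h2 : 1 ≤ m → A + B * q⁻¹ = α) :
    ∑ a : Fin (m + 1), cubic q A B C a = monomialSymm (m + 1) [3] +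
      α • monomialSymm (m + 1) [2, 1] +
      (2 * C * (1 + q⁻¹ + q⁻¹ ^ 2)) • monomialSymm (m + 1) [1, 1, 1] := by
  simp only [cubic_eq_sum, Finset.sum_add_distrib, ← Finset.smul_sum]
  -- For three positions the distinguished one may be lowest, middle or highest, with weight
  -- products `1`, `q⁻¹` and `q⁻²`; each occurs twice, and the total is `6κ`.
  rw [sum_smul_triple (κ := (1 + q⁻¹ + q⁻¹ ^ 2) / 3)]
  · have h3 : ∑ a : Fin (m + 1), ∑ k, (A * weight q a k ^ 2) • (x a * x k ^ 2) +
        ∑ a : Fin (m + 1), ∑ k, (B * weight q a k) • (x a ^ 2 * x k) =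
        α • monomialSymm (m + 1) [2, 1] := by
      rw [Finset.sum_comm, monomialSymm_two_one, Finset.smul_sum, ← Finset.sum_add_distrib]
      refine Finset.sum_congr rfl fun a _ => ?_
      rw [Finset.smul_sum, ← Finset.sum_add_distrib]
      refine Finset.sum_congr rfl fun k _ => ?_
      rw [mul_comm (x k), ← add_smul]
      split_ifs with hak
      · subst hak
        simp [weight]
      · have hm : 1 ≤ m := by omega
        congr 1
        rcases lt_or_gt_of_ne hak with h | h
        · rw [weight, weight, if_pos h, if_neg h.not_gt, if_neg h.ne', mul_one, h1 hm]
        · rw [weight, weight, if_neg h.not_gt, if_neg h.ne', if_pos h, one_pow, mul_one, h2 hm]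
    rw [monomialSymm_three, add_assoc (∑ a : Fin (m + 1), x a ^ 3), h3, smul_smul]
    congr 2
    ring
  · intro a b c hab hbc
    have hac := hab.trans hbc
    simp only [weight, hab, hbc, hac, hab.ne', hbc.ne', hac.ne', hab.not_gt, hbc.not_gt,
      hac.not_gt, if_true, if_false]
    ring

theorem pairPoly_eq_sum {m : ℕ} (q t c : ℂ) {a b : Fin (m + 1)} (hab : a ≠ b) :
    pairPoly q t c a b = x a ^ 2 * x b + ∑ k, pairWeight q t c a b k • triple a b k := by
  have h (k : Fin (m + 1)) : x a * x b * (pairWeight q t c a b k • x k) =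
      (if a = k then x a ^ 2 * x b else 0) + pairWeight q t c a b k • triple a b k := by
    by_cases h1 : a = k
    · subst h1
      simp [triple, pairWeight]
      ring
    · by_cases h2 : b = k
      · subst h2
        simp [pairWeight, hab, hab.symm]
      · rw [if_neg h1, triple, if_neg (by tauto), zero_add, mul_smul_comm]
  rw [pairPoly, Finset.mul_sum]
  simp only [h, Finset.sum_add_distrib, Finset.sum_ite_eq, Finset.mem_univ, if_true]

theorem sum_pairPoly {m : ℕ} (q t c : ℂ) :
    ∑ a : Fin (m + 1), ∑ b, (if a = b then 0 else pairPoly q t c a b) =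
      monomialSymm (m + 1) [2, 1] +
      ((1 + 2 * t) * c + (2 + t) * (c * q⁻¹)) • monomialSymm (m + 1) [1, 1, 1] := by
  have h (a b : Fin (m + 1)) : (if a = b then 0 else pairPoly q t c a b) =
      (if a = b then 0 else x a ^ 2 * x b) + ∑ k, pairWeight q t c a b k • triple a b k := by
    split_ifs with hab
    · simp [triple, hab]
    · exact pairPoly_eq_sum q t c hab
  simp only [h, Finset.sum_add_distrib]
  -- Over the six arrangements of `a`, `b`, `k` in three positions the weights are `c` once, `t c`
  -- twice, `c q⁻¹` twice and `t c q⁻¹` once.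
  rw [monomialSymm_two_one, sum_smul_triple
    (κ := ((1 + 2 * t) * c + (2 + t) * (c * q⁻¹)) / 6)]
  · congr 2
    ring
  · intro a b c hab hbc
    have hac := hab.trans hbc
    simp only [pairWeight, hab, hbc, hac, hab.ne', hbc.ne', hac.ne', hab.ne, hbc.ne, hac.ne,
      hab.not_gt, hbc.not_gt, hac.not_gt, if_true, if_false]
    ring

/-! ### The leading polynomials of the families -/

theorem coeff_mono_self {n : ℕ} (μ : Fin n → ℤ) : (mono μ : Laurent n).coeff μ = 1 := by
  simp [mono]

theorem coeff_mono_of_ne {n : ℕ} {μ ν : Fin n → ℤ} (i : Fin n) (h : μ i ≠ ν i) :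
    (mono μ : Laurent n).coeff ν = 0 := by
  have : μ ≠ ν := fun e => h (by rw [e])
  simp [mono, this]

/-- Passes from ordered to unordered pairs. The factor `2` is the reason why the last parameter of
`cubic` is half the coefficient in the formula for `E`. -/
theorem sum_sq_eq {m n : ℕ} (S : Finset (Fin m)) (f : Fin m → Laurent n) :
    (∑ k ∈ S, f k) ^ 2 - ∑ k ∈ S, f k ^ 2 =
      2 * ∑ k ∈ S, ∑ l ∈ S.filter (k < ·), f k * f l := by
  have h (k l : Fin m) : f k * f l = (if k = l then f k ^ 2 else 0) +
      ((if k < l then f k * f l else 0) + if l < k then f k * f l else 0) := by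
    rcases lt_trichotomy k l with h | h | h
    · simp [h, h.ne, h.not_gt]
    · simp [h, pow_two]
    · simp [h, h.ne', h.not_gt]
  have h2 : ∑ k ∈ S, ∑ l ∈ S, (if l < k then f k * f l else 0) =
      ∑ k ∈ S, ∑ l ∈ S, if k < l then f k * f l else 0 := by
    rw [Finset.sum_comm]
    simp only [mul_comm]
  rw [pow_two, Finset.sum_mul_sum, Finset.sum_congr rfl fun k _ =>
    Finset.sum_congr rfl fun l _ => h k l]
  simp only [Finset.sum_add_distrib, Finset.sum_ite_eq, h2, Finset.sum_filter]
  rw [Finset.sum_congr rfl fun k hk => if_pos hk]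
  ring

theorem cubic_zero {m : ℕ} (q A B C : ℂ) : cubic q A B (C / 2) (0 : Fin (m + 1)) =
    x 0 ^ 3 + A • ∑ k ∈ Finset.Ioi (0 : Fin (m + 1)), x 0 * x k ^ 2 +
      B • ∑ k ∈ Finset.Ioi (0 : Fin (m + 1)), x 0 ^ 2 * x k +
      C • ∑ k ∈ Finset.Ioi (0 : Fin (m + 1)), ∑ l ∈ Finset.Ioi k, x 0 * x k * x l := by
  have h (r : ℕ) (hr : r ≠ 0) : ∑ k, weight q (0 : Fin (m + 1)) k ^ r • (x k : Laurent (m + 1)) ^ r =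
      ∑ k ∈ Finset.Ioi (0 : Fin (m + 1)), x k ^ r := by
    rw [← Finset.sum_subset (Finset.subset_univ (Finset.Ioi 0))]
    · refine Finset.sum_congr rfl fun k hk => ?_
      have hk := Finset.mem_Ioi.mp hk
      rw [weight, if_neg hk.not_gt, if_neg hk.ne', one_pow, one_smul]
    · intro k _ hk
      have hk : k = 0 := by simpa using hk
      simp [hk, weight, hr]
  have h1 := h 1 one_ne_zero
  simp only [pow_one] at h1
  have h3 : ∑ k ∈ Finset.Ioi (0 : Fin (m + 1)), ∑ l ∈ Finset.Ioi k, x 0 * x k * x l =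
      x 0 * ∑ k ∈ Finset.Ioi (0 : Fin (m + 1)),
        ∑ l ∈ (Finset.Ioi (0 : Fin (m + 1))).filter (k < ·), x k * x l := by
    simp only [Finset.mul_sum, mul_assoc]
    refine Finset.sum_congr rfl fun k hk => Finset.sum_congr ?_ fun _ _ => rfl
    ext l
    simp only [Finset.mem_Ioi, Finset.mem_filter] at hk ⊢
    exact ⟨fun h => ⟨hk.trans h, h⟩, fun h => h.2⟩
  have h4 : (algebraMap ℂ (Laurent (m + 1))) C = algebraMap ℂ (Laurent (m + 1)) (C / 2) * 2 := by
    rw [← map_ofNat (algebraMap ℂ (Laurent (m + 1))) 2, ← map_mul]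
    congr 1
    ring
  rw [cubic, h1, h 2 two_ne_zero, sum_sq_eq, h3, ← Finset.mul_sum, ← Finset.mul_sum]
  simp only [Algebra.smul_def, h4]
  ring

theorem coeff_cubic_zero {m : ℕ} (q A B C : ℂ) :
    (cubic q A B (C / 2) (0 : Fin (m + 1))).coeff ((3 : ℤ) • eps 0) = 1 := by
  have h0 : (x 0 ^ 3 : Laurent (m + 1)) = mono ((3 : ℤ) • eps 0) := by
    simp only [x, pow_succ, pow_zero, one_mul, mono_mul]
    congr 1
    module
  rw [cubic_zero, h0]
  simp only [AddMonoidAlgebra.coeff_add, AddMonoidAlgebra.coeff_smul, AddMonoidAlgebra.coeff_sum,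
    Finsupp.add_apply, Finsupp.smul_apply, Finsupp.finsetSum_apply, coeff_mono_self]
  have hk (k) (hk : k ∈ Finset.Ioi (0 : Fin (m + 1))) : (0 : Fin (m + 1)) ≠ k :=
    (Finset.mem_Ioi.mp hk).ne
  rw [Finset.sum_eq_zero fun k h => ?_, Finset.sum_eq_zero fun k h => ?_,
    Finset.sum_eq_zero fun k h => Finset.sum_eq_zero fun l h' => ?_]
  · simp
  · have h1 := hk k h
    have h2 : (0 : Fin (m + 1)) ≠ l := hk l (by
      simp only [Finset.mem_Ioi] at h h' ⊢; exact h.trans h')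
    simp only [x, mono_mul]
    exact coeff_mono_of_ne 0 (by simp [eps, h1, h2])
  · have h1 := hk k h
    simp only [x, pow_two, mono_mul]
    exact coeff_mono_of_ne 0 (by simp [eps, h1])
  · have h1 := hk k h
    simp only [x, pow_two, mono_mul]
    exact coeff_mono_of_ne 0 (by simp [eps, h1])

theorem pairPoly_zero_one {m : ℕ} (hm : 1 ≤ m) (q t c : ℂ) :
    pairPoly q t c (0 : Fin (m + 1)) 1 =
      x 0 ^ 2 * x 1 + c • ∑ k ∈ Finset.Ioi (1 : Fin (m + 1)), x 0 * x 1 * x k := by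
  obtain ⟨m, rfl⟩ : ∃ k, m = k + 1 := ⟨m - 1, by omega⟩
  have h01 : (0 : Fin (m + 2)) < 1 := by simp
  rw [pairPoly_eq_sum _ _ _ h01.ne, Finset.smul_sum,
    ← Finset.sum_subset (Finset.subset_univ (Finset.Ioi (1 : Fin (m + 2))))]
  · congr 1
    refine Finset.sum_congr rfl fun k hk => ?_
    have hk := Finset.mem_Ioi.mp hk
    have hk' := h01.trans hk
    simp only [pairWeight, triple, h01, h01.ne, hk.ne, hk'.ne, hk.ne', hk'.ne', hk.not_gt,
      hk'.not_gt, or_self, if_true, if_false]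
  · intro k _ hk
    have hk : k = 0 ∨ k = 1 := by
      simp only [Finset.mem_Ioi, not_lt, Fin.le_def, Fin.ext_iff, Fin.val_one, Fin.val_zero] at *
      omega
    rcases hk with rfl | rfl <;> simp [triple]

theorem coeff_pairPoly_zero_one {m : ℕ} (hm : 1 ≤ m) (q t c : ℂ) :
    (pairPoly q t c (0 : Fin (m + 1)) 1).coeff ((2 : ℤ) • eps 0 + eps 1) = 1 := by
  have h0 : (x 0 ^ 2 * x 1 : Laurent (m + 1)) = mono ((2 : ℤ) • eps 0 + eps 1) := by
    simp only [x, pow_two, mono_mul]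
    congr 1
    module
  rw [pairPoly_zero_one hm, h0]
  simp only [AddMonoidAlgebra.coeff_add, AddMonoidAlgebra.coeff_smul, AddMonoidAlgebra.coeff_sum,
    Finsupp.add_apply, Finsupp.smul_apply, Finsupp.finsetSum_apply, coeff_mono_self]
  obtain ⟨m, rfl⟩ : ∃ k, m = k + 1 := ⟨m - 1, by omega⟩
  have h01 : (0 : Fin (m + 2)) < 1 := by simp
  rw [Finset.sum_eq_zero fun k h => ?_]
  · simp
  · have h1 : (0 : Fin (m + 2)) ≠ k := (h01.trans (Finset.mem_Ioi.mp h)).ne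
    simp only [x, mono_mul]
    exact coeff_mono_of_ne 0 (by simp [eps, h1])

theorem antitone_smul_eps_zero (m : ℕ) : Antitone ((3 : ℤ) • eps (0 : Fin (m + 1))) := by
  intro a b hab
  rw [smul_eps_apply, smul_eps_apply]
  split_ifs with h1 h2
  · exact le_rfl
  · exact absurd (Fin.le_zero_iff.mp (h1 ▸ hab)) h2
  · norm_num
  · exact le_rfl

theorem antitone_pair_zero_one {m : ℕ} (hm : 1 ≤ m) :
    Antitone ((2 : ℤ) • eps (0 : Fin (m + 1)) + eps 1) := by
  obtain ⟨m, rfl⟩ : ∃ k, m = k + 1 := ⟨m - 1, by omega⟩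
  intro a b hab
  rw [pair_apply, pair_apply]
  simp only [Fin.ext_iff, Fin.le_def, Fin.val_zero, Fin.val_one] at *
  split_ifs <;> omega

theorem antitone_indicatorVec (m : ℕ) :
    Antitone (indicatorVec ({0, 1, 2} : Finset (Fin (m + 3)))) := by
  intro a b hab
  have h : ((2 : Fin (m + 3)) : ℕ) = 2 := Nat.mod_eq_of_lt (show 2 < m + 3 by omega)
  simp only [indicatorVec, Finset.mem_insert, Finset.mem_singleton, Fin.ext_iff, Fin.le_def,
    Fin.val_zero, Fin.val_one, h] at *
  split_ifs <;> omega

/-! ### The Macdonald polynomials -/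

section Main

variable {m : ℕ} {q s : ℂ}

theorem macdonald_three (hq : q ≠ 0) (hs : s ≠ 0)
    (hgen : ∀ a b : ℕ, 1 ≤ a → b ≤ m → q ^ a * (s ^ 2) ^ b ≠ 1) {A B C : ℂ}
    (hA : 1 ≤ m → A * q⁻¹ ^ 2 = (1 - s ^ 2) + A * s ^ 2)
    (hB : 1 ≤ m → B * q⁻¹ = (1 - s ^ 2) + A * (s ^ 2 - 1) + B)
    (hC : 1 ≤ m → 2 * (C / 2 * q⁻¹) = B * (1 - s ^ 2) + 2 * (s ^ 2 * (C / 2))) :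
    (∃! f, IsE q s ((3 : ℤ) • eps (0 : Fin (m + 1))) f) ∧
      E q s ((3 : ℤ) • eps (0 : Fin (m + 1))) = cubic q A B (C / 2) 0 ∧
      P q s ((3 : ℤ) • eps (0 : Fin (m + 1))) = ∑ a, cubic q A B (C / 2) a := by
  have hF := isKZFamily_cubic hq hs (0 : Fin (m + 1)) hA hB hC
  have hanti := antitone_smul_eps_zero m
  have hE := hF.isE hq hs hanti (coeff_cubic_zero q A B C)
  refine ⟨⟨_, hE, fun f hf => hf.unique hq hs hgen hE⟩, hE.E_eq hq hs hgen, ?_⟩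
  rw [hF.P_eq hanti (hE.E_eq hq hs hgen), sum_orbit_single (by norm_num)]
  refine Finset.sum_congr rfl fun a _ => ?_
  have hmem : (3 : ℤ) • eps a ∈ orbit ((3 : ℤ) • eps (0 : Fin (m + 1))) :=
    Finset.mem_image.mpr ⟨Equiv.swap 0 a, Finset.mem_univ _, by
      rw [map_zsmul, permVec_eps, Equiv.swap_apply_left]⟩
  -- Although the minimal permutation is only known abstractly, it takes position `0` to `a`, and
  -- the family depends on nothing else.
  have h1 : permVec _ _ = _ := (transport_spec hmem).1
  rw [map_zsmul, permVec_eps] at h1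
  rw [smul_eps_injective (by norm_num) h1]

theorem macdonald_two_one (hm : 1 ≤ m) (hq : q ≠ 0) (hs : s ≠ 0)
    (hgen : ∀ a b : ℕ, 1 ≤ a → b ≤ m → q ^ a * (s ^ 2) ^ b ≠ 1) {c : ℂ}
    (hc : 2 ≤ m → c * q⁻¹ = 1 - s ^ 2 + s ^ 2 * (s ^ 2 * c)) :
    (∃! f, IsE q s ((2 : ℤ) • eps (0 : Fin (m + 1)) + eps 1) f) ∧
      E q s ((2 : ℤ) • eps (0 : Fin (m + 1)) + eps 1) = pairPoly q (s ^ 2) c 0 1 ∧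
      P q s ((2 : ℤ) • eps (0 : Fin (m + 1)) + eps 1) =
        ∑ a, ∑ b, if a = b then 0 else pairPoly q (s ^ 2) c a b := by
  have h01 : (0 : Fin (m + 1)) ≠ 1 := by
    obtain ⟨m, rfl⟩ : ∃ k, m = k + 1 := ⟨m - 1, by omega⟩
    simp
  have hF := isKZFamily_pairPoly hq hs h01 hc
  have hanti := antitone_pair_zero_one hm
  have hE := hF.isE hq hs hanti (coeff_pairPoly_zero_one hm q (s ^ 2) c)
  refine ⟨⟨_, hE, fun f hf => hf.unique hq hs hgen hE⟩, hE.E_eq hq hs hgen, ?_⟩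
  rw [hF.P_eq hanti (hE.E_eq hq hs hgen), sum_orbit_pair h01]
  refine Finset.sum_congr rfl fun a _ => Finset.sum_congr rfl fun b _ => ?_
  split_ifs with hab
  · rfl
  have hmem : (2 : ℤ) • eps a + eps b ∈ orbit ((2 : ℤ) • eps (0 : Fin (m + 1)) + eps 1) := by
    obtain ⟨w, rfl, rfl⟩ := exists_perm_pair h01 hab
    exact Finset.mem_image.mpr ⟨w, Finset.mem_univ _, by
      rw [map_add, map_zsmul, permVec_eps, permVec_eps]⟩
  have h1 : permVec _ _ = _ := (transport_spec hmem).1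
  rw [map_add, map_zsmul, permVec_eps, permVec_eps] at h1
  obtain ⟨h2, h3⟩ := pair_injective (fun e => h01 (Equiv.injective _ e)) h1
  rw [h2, h3]

theorem macdonald_minuscule (hq : q ≠ 0) (hs : s ≠ 0)
    (hgen : ∀ a b : ℕ, 1 ≤ a → b ≤ m → q ^ a * (s ^ 2) ^ b ≠ 1) {S : Finset (Fin (m + 1))} {k : ℕ}
    (hk : S.card = k) (hS : Antitone (indicatorVec S)) :
    (∃! f, IsE q s (indicatorVec S) f) ∧ E q s (indicatorVec S) = ∏ i ∈ S, x i ∧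
      P q s (indicatorVec S) = elemSymm (m + 1) k := by
  have hF := isKZFamily_mono (q := q) (lam := indicatorVec S) hs fun k => by
    rw [indicatorVec]
    split_ifs <;> simp
  have hE := hF.isE hq hs hS (by rw [permVec_one, coeff_mono_self])
  refine ⟨⟨_, hE, fun f hf => hf.unique hq hs hgen hE⟩, ?_, ?_⟩
  · rw [hE.E_eq hq hs hgen, permVec_one, mono_indicatorVec]
  · rw [hF.P_eq hS (hE.E_eq hq hs hgen), ← hk, ← sum_orbit_indicatorVec]
    refine Finset.sum_congr rfl fun ν hν => ?_
    rw [(transport_spec hν).1]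

end Main

end

end Macdonald

/-! ### The coefficients of the three Macdonald polynomials -/

open Macdonald in
theorem proposition7p1 (m : ℕ) (q s : ℂ) (hq : q ≠ 0) (hs : s ≠ 0) (t : ℂ) (ht : t = s ^ 2)
    -- `n = m + 1` is the number of variables, and `q ^ a * t ^ b ≠ 1` for `a ≥ 1`, `0 ≤ b ≤ n - 1`
    (hgen : ∀ a b : ℕ, 1 ≤ a → b ≤ m → q ^ a * t ^ b ≠ 1) :
    -- the case `3 ε_1`
    ((∃! f, Macdonald.IsE q s (3 • Macdonald.eps (0 : Fin (m + 1))) f) ∧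
      Macdonald.E q s (3 • Macdonald.eps (0 : Fin (m + 1))) =
        Macdonald.x 0 ^ 3
        + ((1 - t) / (1 - q ^ 2 * t) * q ^ 2) •
            ∑ k ∈ Finset.Ioi (0 : Fin (m + 1)), Macdonald.x 0 * Macdonald.x k ^ 2
        + ((1 - t) / (1 - q * t) * (1 + (1 - t) / (1 - q ^ 2 * t) * q) * q) •
            ∑ k ∈ Finset.Ioi (0 : Fin (m + 1)), Macdonald.x 0 ^ 2 * Macdonald.x k
        + ((1 - t) / (1 - q * t) * ((1 - t) / (1 - q ^ 2 * t)) * (1 + q) * q ^ 2) •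
            ∑ k ∈ Finset.Ioi (0 : Fin (m + 1)), ∑ l ∈ Finset.Ioi k,
              Macdonald.x 0 * Macdonald.x k * Macdonald.x l ∧
      Macdonald.P q s (3 • Macdonald.eps (0 : Fin (m + 1))) =
        Macdonald.monomialSymm (m + 1) [3]
        + ((1 - q ^ 3) / (1 - t * q ^ 2) * ((1 - t) / (1 - q))) •
            Macdonald.monomialSymm (m + 1) [2, 1]
        + ((1 - q ^ 3) / (1 - t * q ^ 2) * ((1 - q ^ 2) / (1 - t * q)) *
              ((1 - t) / (1 - q)) ^ 2) •
            Macdonald.monomialSymm (m + 1) [1, 1, 1]) ∧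
    -- the case `2 ε_1 + ε_2`, for `n ≥ 2`
    (1 ≤ m →
      (∃! f, Macdonald.IsE q s
        (2 • Macdonald.eps (0 : Fin (m + 1)) + Macdonald.eps (1 : Fin (m + 1))) f) ∧
      Macdonald.E q s (2 • Macdonald.eps (0 : Fin (m + 1)) + Macdonald.eps (1 : Fin (m + 1))) =
        Macdonald.x 0 ^ 2 * Macdonald.x 1
        + ((1 - t) / (1 - q * t ^ 2) * q) •
            ∑ k ∈ Finset.Ioi (1 : Fin (m + 1)), Macdonald.x 0 * Macdonald.x 1 * Macdonald.x k ∧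
      Macdonald.P q s (2 • Macdonald.eps (0 : Fin (m + 1)) + Macdonald.eps (1 : Fin (m + 1))) =
        Macdonald.monomialSymm (m + 1) [2, 1]
        + ((1 - t ^ 2) / (1 - q * t) * ((1 - q ^ 2 * t) / (1 - q * t ^ 2))
              + (1 - t) / (1 - q) * ((1 - q ^ 2) / (1 - q * t))) •
            Macdonald.monomialSymm (m + 1) [1, 1, 1]) ∧
    -- the case `ε_1 + ε_2 + ε_3`, for `n ≥ 3`
    (2 ≤ m →
      (∃! f, Macdonald.IsE q s (Macdonald.eps (0 : Fin (m + 1)) +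
        Macdonald.eps (1 : Fin (m + 1)) + Macdonald.eps (2 : Fin (m + 1))) f) ∧
      Macdonald.E q s (Macdonald.eps (0 : Fin (m + 1)) +
          Macdonald.eps (1 : Fin (m + 1)) + Macdonald.eps (2 : Fin (m + 1))) =
        Macdonald.x 0 * Macdonald.x 1 * Macdonald.x 2 ∧
      Macdonald.P q s (Macdonald.eps (0 : Fin (m + 1)) +
          Macdonald.eps (1 : Fin (m + 1)) + Macdonald.eps (2 : Fin (m + 1))) =
        Macdonald.monomialSymm (m + 1) [1, 1, 1] ∧
      Macdonald.monomialSymm (m + 1) [1, 1, 1] = Macdonald.elemSymm (m + 1) 3) := by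
  subst ht
  -- The denominators `1 - q^a t` involve `t^1`, so their nonvanishing is assumed only from two
  -- variables on.
  have hm1 (hm : 1 ≤ m) (a : ℕ) (ha : 1 ≤ a) : 1 - q ^ a * s ^ 2 ≠ 0 := fun h =>
    hgen a 1 ha hm (by linear_combination -h)
  have hq1 : 1 - q ≠ 0 := fun h => hgen 1 0 le_rfl (Nat.zero_le _) (by linear_combination -h)
  -- The numerals in the statement act as natural numbers, those in the lemmas as integers.
  have hz3 (v : Fin (m + 1) → ℤ) : (3 : ℕ) • v = (3 : ℤ) • v := by
    rw [← natCast_zsmul]; rfl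
  have hz2 (v : Fin (m + 1) → ℤ) : (2 : ℕ) • v = (2 : ℤ) • v := by
    rw [← natCast_zsmul]; rfl
  refine ⟨?_, fun hm => ?_, fun hm => ?_⟩
  · rw [hz3]
    -- The factor `1 - q t` cancels from the coefficient of `x_1² x_k`, so the conditions on `A` and
    -- `B` involve the denominator `1 - q² t` only.
    have hB (hm : 1 ≤ m) : (1 - s ^ 2) / (1 - q * s ^ 2) *
        (1 + (1 - s ^ 2) / (1 - q ^ 2 * s ^ 2) * q) * q =
        (1 - s ^ 2) * q * (1 + q) / (1 - q ^ 2 * s ^ 2) := by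
      have h1 := hm1 hm 1 le_rfl
      have h2 := hm1 hm 2 (by norm_num)
      rw [pow_one] at h1
      generalize s ^ 2 = t at *
      generalize hd0 : 1 - q * t = d0 at *
      generalize hd1 : 1 - q ^ 2 * t = d1 at *
      field_simp
      subst hd0 hd1
      ring
    obtain ⟨h1, h2, h3⟩ := macdonald_three (m := m) hq hs hgen
      (A := (1 - s ^ 2) / (1 - q ^ 2 * s ^ 2) * q ^ 2)
      (B := (1 - s ^ 2) / (1 - q * s ^ 2) * (1 + (1 - s ^ 2) / (1 - q ^ 2 * s ^ 2) * q) * q)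
      (C := (1 - s ^ 2) / (1 - q * s ^ 2) * ((1 - s ^ 2) / (1 - q ^ 2 * s ^ 2)) * (1 + q) * q ^ 2)
      (fun hm => by
        have h2 := hm1 hm 2 (by norm_num)
        generalize s ^ 2 = t at *
        generalize hd0 : 1 - q ^ 2 * t = d0 at *
        field_simp
        subst hd0
        ring)
      (fun hm => by
        have h2 := hm1 hm 2 (by norm_num)
        rw [hB hm]
        generalize s ^ 2 = t at *
        generalize hd0 : 1 - q ^ 2 * t = d0 at *
        field_simp
        subst hd0
        ring)
      (fun hm => by
        have h1 := hm1 hm 1 le_rfl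
        have h2 := hm1 hm 2 (by norm_num)
        rw [pow_one] at h1
        rw [hB hm]
        generalize s ^ 2 = t at *
        generalize hd0 : 1 - q * t = d0 at *
        generalize hd1 : 1 - q ^ 2 * t = d1 at *
        field_simp
        subst hd0 hd1
        ring)
    refine ⟨h1, h2.trans (cubic_zero _ _ _ _), h3.trans ?_⟩
    rw [sum_cubic (α := (1 - q ^ 3) / (1 - s ^ 2 * q ^ 2) * ((1 - s ^ 2) / (1 - q)))
      (fun hm => by
        have h2 := hm1 hm 2 (by norm_num)
        rw [hB hm, mul_comm (s ^ 2) (q ^ 2)]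
        generalize s ^ 2 = t at *
        generalize hd0 : 1 - q ^ 2 * t = d0 at *
        field_simp
        subst hd0
        ring)
      (fun hm => by
        have h2 := hm1 hm 2 (by norm_num)
        rw [hB hm, mul_comm (s ^ 2) (q ^ 2)]
        generalize s ^ 2 = t at *
        generalize hd0 : 1 - q ^ 2 * t = d0 at *
        field_simp
        subst hd0
        ring)]
    congr 2
    rw [mul_comm (s ^ 2) (q ^ 2), mul_comm (s ^ 2) q]
    have e : 1 - q ^ 3 = (1 - q) * (1 + q + q ^ 2) := by ring
    have e' : 1 - q ^ 2 = (1 - q) * (1 + q) := by ring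
    rw [e, e']
    simp only [div_eq_mul_inv]
    -- The identity is polynomial in these two inverses and uses only `q ≠ 0` and `1 - q ≠ 0`; it
    -- therefore also holds for one variable, where the denominators may be zero.
    generalize (1 - q * s ^ 2)⁻¹ = r
    generalize (1 - q ^ 2 * s ^ 2)⁻¹ = r'
    field_simp
    ring
  · rw [hz2]
    have hm2 (hm : 2 ≤ m) : 1 - q * (s ^ 2) ^ 2 ≠ 0 := fun h =>
      hgen 1 2 le_rfl hm (by linear_combination -h)
    obtain ⟨h1, h2, h3⟩ := macdonald_two_one hm hq hs hgen
      (c := (1 - s ^ 2) / (1 - q * (s ^ 2) ^ 2) * q) (fun h => by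
        have h1 := hm2 h
        generalize s ^ 2 = t at *
        generalize hd0 : 1 - q * t ^ 2 = d0 at *
        field_simp
        subst hd0
        ring)
    refine ⟨h1, h2.trans (pairPoly_zero_one hm _ _ _), h3.trans ?_⟩
    rw [sum_pairPoly]
    -- For two variables `1 - q t²` may vanish, but then the coefficient multiplies `m_{1^3} = 0`.
    by_cases hm' : 2 ≤ m
    · congr 2
      have h1 := hm2 hm'
      have h3 := hm1 hm 1 le_rfl
      rw [pow_one] at h3
      generalize s ^ 2 = t at *
      generalize hd0 : 1 - q * t = d0 at *
      generalize hd1 : 1 - q * t ^ 2 = d1 at *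
      field_simp
      subst hd0 hd1
      ring
    · have h4 : monomialSymm (m + 1) [1, 1, 1] = 0 := by
        rw [monomialSymm, if_neg]
        simp
        omega
      rw [h4, smul_zero, smul_zero]
  · obtain ⟨m, rfl⟩ : ∃ k, m = k + 2 := ⟨m - 2, by omega⟩
    have h2 : 2 % (m + 3) = 2 := Nat.mod_eq_of_lt (by omega)
    have h2' : ((2 : Fin (m + 3)) : ℕ) = 2 := h2
    have e : eps (0 : Fin (m + 3)) + eps 1 + eps 2 = indicatorVec {0, 1, 2} := by
      ext i
      simp only [eps, Pi.add_apply, Pi.single_apply, indicatorVec, Finset.mem_insert,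
        Finset.mem_singleton, Fin.ext_iff, Fin.val_zero, Fin.val_one, h2']
      split_ifs <;> omega
    have e' : (x 0 * x 1 * x 2 : Laurent (m + 3)) = ∏ i ∈ {0, 1, 2}, x i := by
      rw [Finset.prod_insert (by simp [Fin.ext_iff, h2]),
        Finset.prod_insert (by simp [Fin.ext_iff, h2]), Finset.prod_singleton, mul_assoc]
    rw [e, e', monomialSymm_one_one_one]
    obtain ⟨h3, h4, h5⟩ := macdonald_minuscule hq hs hgen (card_zero_one_two m)
      (antitone_indicatorVec m)
    exact ⟨h3, h4, h5, rfl⟩
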